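/- Let $(D(k))_{k\ge1}$ be i.i.d. real random variables with finite variance $\sigma_D^2=\mathrm{Var}(D(k))<\infty$, negative mean, $\delta:=-\mathbb E[D(k)]>0$, and $\mathbb P\{D(k)>0\}>0$. Let $\Phi$ be the reflected random walk on $\mathbb R_+=[0,\infty)$, $$\Phi(k+1)=[\Phi(k)+D(k+1)]_+,\qquad k\ge0,\quad [x]_+=\max(x,0),$$ with transition kernel $P(x,A)=\mathbb P\{[x+D(1)]_+\in A\}$; write $\mathbf E_x$ for expectation when $\Phi(0)=x$, and $\tau_0=\min\{k\ge1:\Phi(k)=0\}$. For a kernel $Q$, $Q^n$ denotes the $n$-fold composition and $Qg(x)=\int g(y)\,Q(x,dy)$. A measurable function $s\ge0$ and a probability measure $\nu$ are called small for $Q$ if $Q^n(x,A)\ge s(x)\nu(A)$ for some $n\ge1$ and all $x$ and measurable $A$; a measurable set $C$ is small if $\varepsilon\mathbb 1_C$ is a small function (with some $\nu$) for some $\varepsilon>0$. Then: (i) With $V(x)=1+\tfrac12\delta^{-1}(x^2+\delta x)$, the function $V$ is $P(x,\cdot)$-integrable for every $x$, and there is a bounded function $R:\mathbb R_+\to\mathbb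 R$ such that $$PV(x)=V(x)-x+R(x),\qquad x\in\mathbb R_+ .$$ Moreover condition (V3) holds for $V$ with $W(x)=1+\tfrac12x$: there are a small set $C$ for $P$ and a constant $b<\infty$ with $PV\le V-W+b\mathbb 1_C$ on $\mathbb R_+$. (ii) For each $x\in\mathbb R_+$, $$\lim_{r\to\infty}r^{-1}\,\mathbf E_{rx}[\tau_0]=\delta^{-1}x,\qquad \lim_{r\to\infty}r^{-2}\,\mathbf E_{rx}\Big[\sum_{k=0}^{\tau_0-1}\Phi(k)\Big]=\tfrac12\delta^{-1}x^2 .$$ (iii) There is a unique invariant probability measure $\pi$ for $P$, and $\int e^{\beta x}\,\pi(dx)=\infty$ for all sufficiently large $\beta>0$. (iv) For $a>0$ let $P_{f_a}(x,A)=e^{ax}P(x,A)$. The semigroup $\{P_{f_a}^n\}$ is $\psi$-irreducible and aperiodic: for every $x$ and every measurable $A$ with $\pi(A)>0$ one has $P_{f_a}^n(x,A)>0$ for some $n\ge 0$, and indeed for all large $n$. There exist small pairs $(s,\nu)$ for $P_{f_a}$ with $\pi(s)>0$. Its generalized principal eigenvalue $\lambda_a=e^{\Lambda_a}$, where $$\Lambda_a=\lim_{n\to\infty}\frac1n\log\big(\nu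 P_{f_a}^n s\big)\in[-\infty,\infty]$$ for every such pair $(s,\nu)$, is $\lambda_a=\infty$ for every $a>0$. -/

import Mathlib

open MeasureTheory ProbabilityTheory Filter Topology
open scoped NNReal ENNReal

noncomputable section

namespace RRW

section GeneralKernels

variable {X : Type*} [MeasurableSpace X]

/-- The measurable function `s ≥ 0` and the probability measure `ν` are small for `Q`:
`Q^n(x, A) ≥ s(x) ν(A)` for some `n ≥ 1` and all `x`, `A`. Powers of kernels are compositions. -/
def IsSmallPair (Q : Kernel X X) (s : X → ℝ≥0) (ν : Measure X) : Prop :=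
  Measurable s ∧ IsProbabilityMeasure ν ∧
    ∃ n : ℕ, 1 ≤ n ∧ ∀ x : X, ∀ A : Set X, MeasurableSet A →
      (s x : ℝ≥0∞) * ν A ≤ (Q ^ n) x A

/-- The set `C` is small: `ε 𝟙_C` is a small function for some `ε > 0`. -/
def IsSmallSet (Q : Kernel X X) (C : Set X) : Prop :=
  MeasurableSet C ∧ ∃ ε : ℝ≥0, 0 < ε ∧ ∃ ν : Measure X,
    IsSmallPair Q (C.indicator fun _ => ε) ν

/-- The drift condition (V3): `W ≥ 1` and `PV ≤ V - W + b 𝟙_C` on `{V < ∞}`, for some small set `C`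
and some finite constant `b`. The inequality is written in `[0, ∞]` as `PV + W ≤ V + b 𝟙_C`. -/
def DriftV3 (P : Kernel X X) (V : X → ℝ≥0∞) (W : X → ℝ) : Prop :=
  Measurable V ∧ Measurable W ∧ (∀ x, 1 ≤ W x) ∧
    ∃ C : Set X, IsSmallSet P C ∧ ∃ b : ℝ≥0, ∀ x, V x < ∞ →
      (∫⁻ y, V y ∂(P x)) + ENNReal.ofReal (W x) ≤ V x + C.indicator (fun _ => (b : ℝ≥0∞)) x

/-- The scaled kernel `P_h(x, A) = h(x) P(x, A)`, for measurable `h`. -/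
def scaledKernel (P : Kernel X X) (h : X → ℝ≥0) (hh : Measurable h) : Kernel X X where
  toFun x := (h x : ℝ≥0∞) • P x
  measurable' := by
    refine Measure.measurable_of_measurable_coe _ fun A hA => ?_
    simp only [Measure.smul_apply, smul_eq_mul]
    exact hh.coe_nnreal_ennreal.mul (Kernel.measurable_coe P hA)

/-- Aperiodicity of the semigroup `{Q^k}`: for all `x` and all measurable `A` with `π(A) > 0`, the
indicator of `Q^k(x, A) > 0` has `liminf` equal to one, i.e. it is one for all large `k`. -/
def IsAperiodic (Q : Kernel X X) (π : Measure X) : Prop :=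
  ∀ x : X, ∀ A : Set X, MeasurableSet A → 0 < π A → ∀ᶠ k : ℕ in atTop, 0 < (Q ^ k) x A

/-- `l ∈ [0, ∞]` is the generalized principal eigenvalue of `Q`: the semigroup is irreducible and
aperiodic, small pairs `(s, ν)` with `π(s) > 0` exist, and `l = e^Λ`, where
`Λ = lim (1/n) log (ν Q^n s) ∈ [-∞, ∞]` for every such pair. -/
def IsGPE (Q : Kernel X X) (π : Measure X) (l : ℝ≥0∞) : Prop :=
  Kernel.IsIrreducible π Q ∧ IsAperiodic Q π ∧
    (∃ (s : X → ℝ≥0) (ν : Measure X), IsSmallPair Q s ν ∧ 0 < ∫⁻ x, (s x : ℝ≥0∞) ∂π) ∧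
    ∃ Λ : EReal, l = EReal.exp Λ ∧
      ∀ (s : X → ℝ≥0) (ν : Measure X), IsSmallPair Q s ν → 0 < ∫⁻ x, (s x : ℝ≥0∞) ∂π →
        Tendsto (fun n : ℕ =>
          ENNReal.log (∫⁻ x, ∫⁻ y, (s y : ℝ≥0∞) ∂((Q ^ n) x) ∂ν) / ((n : ℝ) : EReal))
          atTop (𝓝 Λ)

end GeneralKernels

/-- The transition kernel of the reflected random walk on `[0, ∞)` whose increments have law `μ`:
`P(x, ·)` is the law of `[x + D]_+` with `D ∼ μ`. -/
def rwKernel (μ : Measure ℝ) [SFinite μ] : Kernel ℝ≥0 ℝ≥0 where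
  toFun x := μ.map fun d : ℝ => ((x : ℝ) + d).toNNReal
  measurable' := by
    have hm : Measurable fun p : ℝ≥0 × ℝ => ((p.1 : ℝ) + p.2).toNNReal := by fun_prop
    refine Measure.measurable_of_measurable_coe _ fun A hA => ?_
    have h2 : ∀ x : ℝ≥0, (μ.map fun d : ℝ => ((x : ℝ) + d).toNNReal) A
        = μ (Prod.mk x ⁻¹' ((fun p : ℝ≥0 × ℝ => ((p.1 : ℝ) + p.2).toNNReal) ⁻¹' A)) := by
      intro x
      rw [Measure.map_apply (by fun_prop) hA]
      rfl
    simp only [h2]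
    exact measurable_measure_prodMk_left (hm hA)

variable {Ω : Type*}

/-- The reflected random walk started from `x`: `Φ(0) = x`, `Φ(k+1) = [Φ(k) + D(k+1)]_+`.
The increment of the step from time `k` to time `k + 1` is `D k`. -/
def walk (D : ℕ → Ω → ℝ) (x : ℝ≥0) : ℕ → Ω → ℝ≥0
  | 0, _ => x
  | k + 1, ω => ((walk D x k ω : ℝ) + D k ω).toNNReal

/-- The first return time to the origin, `τ₀ = min {k ≥ 1 : Φ(k) = 0}`, infinite if there is none,
of the walk started from `x`. -/
def returnTime (D : ℕ → Ω → ℝ) (x : ℝ≥0) (ω : Ω) : ℕ∞ :=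
  ⨅ (k : ℕ) (_ : 1 ≤ k ∧ walk D x k ω = 0), (k : ℕ∞)

/-- The sum `∑_{k < τ₀} Φ(k)` along a path of the walk started from `x`. -/
def pathSum (D : ℕ → Ω → ℝ) (x : ℝ≥0) (ω : Ω) : ℝ≥0∞ :=
  ∑' k : ℕ, if (k : ℕ∞) < returnTime D x ω then (walk D x k ω : ℝ≥0∞) else 0

/-- The Lyapunov function `V(x) = 1 + (x² + δ x) / (2 δ)`. -/
def lyapunov (δ : ℝ) (x : ℝ≥0) : ℝ := 1 + 1 / 2 * δ⁻¹ * ((x : ℝ) ^ 2 + δ * x)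

/-- The weight `e^{a x}`. -/
def expWeight (a : ℝ) (x : ℝ≥0) : ℝ≥0 := (Real.exp (a * x)).toNNReal

theorem measurable_expWeight (a : ℝ) : Measurable (expWeight a) := by
  unfold expWeight
  fun_prop

end RRW

end

/-! Everything rests on two kinds of move: with probability at least `q` an increment lies in [ε,
ε⁻¹], and with probability at least `q` it is at most -ε.

(i) Without reflection the quadratic V has drift -x plus a constant. Reflection changes this by an
amount controlled by |d|, uniformly in x. Bounded intervals are small because enough downward moves
lead to the atom 0.

(ii) Both expectations are series ∑ Kᵏf(x), where K is the kernel killed at 0 and f is 1 or the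
identity. They are squeezed between super- and subsolutions of w = f + Kw with the right leading
term (`tsum_iterate_killedOp_le`, `le_tsum_iterate_killedOp`).

(iii) Reversing the increments turns Φ(n) into max(Mₙ, x + Sₙ), with Sₙ the partial sums and Mₙ
their running maximum. By the strong law Sₙ → -∞, so this is almost surely eventually constant, with
a value free of x. Hence Pⁿ(x, ·) converges setwise to one law π, which is the unique invariant
probability. Upward moves give π a tail of at least qⁿ beyond nε, so large exponential moments
diverge.

(iv) Since e^{ax} ≥ 1, the scaled kernel dominates P, and positivity follows from Pⁿ(x, A) → π(A). A
climb of n steps from 0 collects weight with exponent quadratic in n, while the climb and the return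
cost a probability exponential in a multiple of n. So the mass returned to 0 outgrows every
exponential (`eventually_exp_le_pow_scaledKernel`), and every pair (s, ν) inherits this growth. -/

namespace RRW

/-! ### Powers of kernels -/

section KernelPowers

variable {X : Type*} [MeasurableSpace X]

theorem lintegral_pow_add (Q : Kernel X X) (m n : ℕ) (x : X) {f : X → ℝ≥0∞} (hf : Measurable f) :
    ∫⁻ z, f z ∂((Q ^ (n + m)) x) = ∫⁻ y, ∫⁻ z, f z ∂((Q ^ m) y) ∂((Q ^ n) x) := by
  rw [add_comm, Kernel.pow_add, Kernel.lintegral_comp _ _ _ hf]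

/-- Chapman-Kolmogorov, keeping only the paths that are in `B` at time `n`. All lower bounds along
prescribed paths are chained with it. -/
theorem mul_pow_apply_le (Q : Kernel X X) {m n : ℕ} {x : X} {A B : Set X} {c : ℝ≥0∞}
    (hA : MeasurableSet A) (hB : MeasurableSet B) (h : ∀ y ∈ B, c ≤ (Q ^ m) y A) :
    c * (Q ^ n) x B ≤ (Q ^ (n + m)) x A := by
  rw [Kernel.pow_add_apply_eq_lintegral _ _ _ _ hA, ← lintegral_indicator_const hB]
  refine lintegral_mono fun y => ?_
  by_cases hy : y ∈ B
  · simpa [hy] using h y hy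
  · simp [hy]

theorem pow_zero_apply (Q : Kernel X X) (x : X) : (Q ^ 0) x = Measure.dirac x := by
  rw [pow_zero]; rfl

theorem pow_le_pow_scaledKernel (P : Kernel X X) {h : X → ℝ≥0} (hh : Measurable h)
    (h1 : ∀ x, 1 ≤ h x) (n : ℕ) (x : X) : (P ^ n) x ≤ (scaledKernel P h hh ^ n) x := by
  induction n generalizing x with
  | zero => simp [pow_zero]
  | succ n ih =>
    refine Measure.le_iff.2 fun A hA => ?_
    rw [Kernel.pow_succ_apply_eq_lintegral _ _ _ hA, Kernel.pow_succ_apply_eq_lintegral _ _ _ hA]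
    refine lintegral_mono' (ih x) fun y => ?_
    change P y A ≤ ((h y : ℝ≥0∞) • P y) A
    rw [Measure.smul_apply, smul_eq_mul]
    exact le_mul_of_one_le_left zero_le (by exact_mod_cast h1 y)

instance instIsMarkovKernelPow (P : Kernel X X) [IsMarkovKernel P] (n : ℕ) :
    IsMarkovKernel (P ^ n) := by
  induction n with
  | zero => rw [pow_zero]; exact inferInstanceAs (IsMarkovKernel Kernel.id)
  | succ n ih => rw [pow_succ]; exact inferInstanceAs (IsMarkovKernel ((P ^ n) ∘ₖ P))

end KernelPowers

/-! ### Upward and downward moves of the reflected walk -/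

section Kernel

variable (ν : Measure ℝ)

/-- These intervals grow as `η` decreases and exhaust the positive half-line. The monotonicity lets
one scale serve both directions; the upper end bounds the height of a climb, hence the time needed
to come down. -/
theorem exists_pos_measure_Icc (hpos : 0 < ν (Set.Ioi 0)) :
    ∃ ε : ℝ, 0 < ε ∧ ∀ η, 0 < η → η ≤ ε → 0 < ν (Set.Icc η η⁻¹) := by
  have hU : Set.Ioi (0 : ℝ) = ⋃ n : ℕ, Set.Icc ((n : ℝ) + 1)⁻¹ ((n : ℝ) + 1) := by
    ext x
    simp only [Set.mem_Ioi, Set.mem_iUnion, Set.mem_Icc]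
    constructor
    · intro hx
      obtain ⟨n, hn⟩ := exists_nat_ge (max x x⁻¹)
      refine ⟨n, ?_, by linarith [le_max_left x x⁻¹]⟩
      exact inv_le_of_inv_le₀ hx (by linarith [le_max_right x x⁻¹])
    · rintro ⟨n, h, -⟩
      exact lt_of_lt_of_le (by positivity) h
  have : ∃ n : ℕ, ν (Set.Icc ((n : ℝ) + 1)⁻¹ ((n : ℝ) + 1)) ≠ 0 := by
    by_contra! h
    rw [hU, measure_iUnion_null h] at hpos
    exact lt_irrefl _ hpos
  obtain ⟨n, hn⟩ := this
  refine ⟨((n : ℝ) + 1)⁻¹, by positivity, fun η hη hle => ?_⟩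
  refine (pos_iff_ne_zero.2 hn).trans_le (measure_mono (Set.Icc_subset_Icc hle ?_))
  exact le_inv_of_le_inv₀ hη hle

theorem exists_pos_measure_Iic (hneg : 0 < ν (Set.Iio 0)) :
    ∃ ε : ℝ, 0 < ε ∧ ∀ η, 0 < η → η ≤ ε → 0 < ν (Set.Iic (-η)) := by
  have hU : Set.Iio (0 : ℝ) = ⋃ n : ℕ, Set.Iic (-((n : ℝ) + 1)⁻¹) := by
    ext x
    simp only [Set.mem_Iio, Set.mem_iUnion, Set.mem_Iic]
    constructor
    · intro hx
      obtain ⟨n, hn⟩ := exists_nat_ge ((-x)⁻¹)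
      refine ⟨n, ?_⟩
      have : ((n : ℝ) + 1)⁻¹ ≤ -x := inv_le_of_inv_le₀ (by linarith) (by linarith)
      linarith
    · rintro ⟨n, h⟩
      have : (0 : ℝ) < ((n : ℝ) + 1)⁻¹ := by positivity
      linarith
  have : ∃ n : ℕ, ν (Set.Iic (-((n : ℝ) + 1)⁻¹)) ≠ 0 := by
    by_contra! h
    rw [hU, measure_iUnion_null h] at hneg
    exact lt_irrefl _ hneg
  obtain ⟨n, hn⟩ := this
  refine ⟨((n : ℝ) + 1)⁻¹, by positivity, fun η hη hle => ?_⟩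
  exact (pos_iff_ne_zero.2 hn).trans_le (measure_mono (Set.Iic_subset_Iic.2 (by linarith)))

variable [IsProbabilityMeasure ν]

theorem measurable_step (x : ℝ≥0) : Measurable fun d : ℝ => ((x : ℝ) + d).toNNReal := by
  fun_prop

theorem rwKernel_apply (x : ℝ≥0) :
    rwKernel ν x = ν.map fun d : ℝ => ((x : ℝ) + d).toNNReal := rfl

theorem rwKernel_apply' (x : ℝ≥0) {A : Set ℝ≥0} (hA : MeasurableSet A) :
    rwKernel ν x A = ν ((fun d : ℝ => ((x : ℝ) + d).toNNReal) ⁻¹' A) := by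
  rw [rwKernel_apply, Measure.map_apply (measurable_step x) hA]

theorem lintegral_rwKernel (x : ℝ≥0) {f : ℝ≥0 → ℝ≥0∞} (hf : Measurable f) :
    ∫⁻ y, f y ∂(rwKernel ν x) = ∫⁻ d, f ((x : ℝ) + d).toNNReal ∂ν := by
  rw [rwKernel_apply, lintegral_map hf (measurable_step x)]

instance instIsMarkovKernelRwKernel : IsMarkovKernel (rwKernel ν) where
  isProbabilityMeasure x := Measure.isProbabilityMeasure_map (measurable_step x).aemeasurable

/-- A common scale `ε` at which the increments exceed `ε`, while staying below `ε⁻¹`, and fall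
below `-ε`, each with probability at least `q`. -/
theorem exists_scale (hpos : 0 < ν (Set.Ioi 0)) (hneg : 0 < ν (Set.Iio 0)) :
    ∃ ε q : ℝ, 0 < ε ∧ 0 < q ∧ q ≤ 1 ∧ ENNReal.ofReal q ≤ ν (Set.Icc ε ε⁻¹) ∧
      ENNReal.ofReal q ≤ ν (Set.Iic (-ε)) := by
  obtain ⟨ε₁, h₁, H₁⟩ := exists_pos_measure_Icc ν hpos
  obtain ⟨ε₂, h₂, H₂⟩ := exists_pos_measure_Iic ν hneg
  have hε : 0 < min ε₁ ε₂ := lt_min h₁ h₂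
  have p₁ := H₁ _ hε (min_le_left _ _)
  have p₂ := H₂ _ hε (min_le_right _ _)
  set ε := min ε₁ ε₂
  have t₁ := ENNReal.toReal_pos p₁.ne' (measure_ne_top _ _)
  refine ⟨ε, min (ν (Set.Icc ε ε⁻¹)).toReal (ν (Set.Iic (-ε))).toReal, hε,
    lt_min t₁ (ENNReal.toReal_pos p₂.ne' (measure_ne_top _ _)), ?_, ?_, ?_⟩
  · exact (min_le_left _ _).trans (ENNReal.toReal_mono ENNReal.one_ne_top prob_le_one)
  · exact (ENNReal.ofReal_le_ofReal (min_le_left _ _)).trans ENNReal.ofReal_toReal_le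
  · exact (ENNReal.ofReal_le_ofReal (min_le_right _ _)).trans ENNReal.ofReal_toReal_le

variable {ν} {ε q : ℝ}

/-- A step of at most -ε lowers the walk by ε or puts it at 0, and keeps it at 0 once there, so
spare steps do no harm. -/
theorem ofReal_pow_le_pow_apply_zero (hq : 0 ≤ q)
    (hdown : ENNReal.ofReal q ≤ ν (Set.Iic (-ε))) (n : ℕ) (x : ℝ≥0) (hx : (x : ℝ) ≤ n * ε) :
    ENNReal.ofReal (q ^ n) ≤ (rwKernel ν ^ n) x {0} := by
  induction n generalizing x with
  | zero =>
    have : x = 0 := by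
      rw [← NNReal.coe_eq_zero]; exact le_antisymm (by simpa using hx) x.2
    rw [pow_zero_apply, this]; simp
  | succ n ih =>
    have hB : MeasurableSet {y : ℝ≥0 | (y : ℝ) ≤ n * ε} := by measurability
    have h := mul_pow_apply_le (rwKernel ν) (n := 1) (x := x) (measurableSet_singleton 0) hB
      (fun y hy => ih y hy)
    rw [add_comm 1 n] at h
    refine le_trans ?_ h
    rw [pow_succ, ENNReal.ofReal_mul (by positivity), pow_one, rwKernel_apply' _ _ hB]
    gcongr
    refine hdown.trans (measure_mono fun d hd => ?_)
    simp only [Set.mem_preimage, Set.mem_ofPred_eq, Set.mem_Iic] at hd ⊢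
    push_cast at hx
    by_cases h0 : 0 ≤ (x : ℝ) + d
    · rw [Real.coe_toNNReal _ h0]; linarith
    · rw [Real.toNNReal_of_nonpos (by linarith)]
      -- The sign of ε is not assumed: a negative value would contradict `hx`, as x ≥ 0.
      have : 0 ≤ ε := by
        by_contra hε
        have : ((n : ℝ) + 1) * ε ≤ ε := by nlinarith [(Nat.cast_nonneg n : (0:ℝ) ≤ n)]
        linarith [x.2]
      simpa using mul_nonneg (Nat.cast_nonneg n) this

theorem isSmallSet_Iic (hε : 0 < ε) (hq : 0 < q)
    (hdown : ENNReal.ofReal q ≤ ν (Set.Iic (-ε))) (M : ℝ) :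
    IsSmallSet (rwKernel ν) {x : ℝ≥0 | (x : ℝ) ≤ M} := by
  obtain ⟨n, hn⟩ := exists_nat_ge (M / ε)
  -- The extra step ensures that the power in the definition of smallness is at least 1.
  have hM : M ≤ ((n + 1 : ℕ) : ℝ) * ε := by
    rw [div_le_iff₀ hε] at hn; push_cast; linarith
  have hC : MeasurableSet {x : ℝ≥0 | (x : ℝ) ≤ M} := by measurability
  refine ⟨hC, (q ^ (n + 1)).toNNReal, by simpa using pow_pos hq _, Measure.dirac 0,
    measurable_const.indicator hC, inferInstance, n + 1, by omega, fun x A hA => ?_⟩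
  by_cases hx : x ∈ {x : ℝ≥0 | (x : ℝ) ≤ M}
  · rw [Set.indicator_of_mem hx]
    by_cases h0 : (0 : ℝ≥0) ∈ A
    · simp only [Measure.dirac_apply' _ hA, Set.indicator_of_mem h0, Pi.one_apply, mul_one]
      exact (ofReal_pow_le_pow_apply_zero hq.le hdown _ x (le_trans hx hM)).trans
        (measure_mono (by simpa using h0))
    · simp [Measure.dirac_apply' _ hA, h0]
  · rw [Set.indicator_of_notMem hx]; simp

/-- The walk started at the origin is above `n ε` after `n` steps with probability at least
`q ^ n`, with a gain from the exponential weights which is quadratic in the exponent. -/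
theorem ofReal_le_pow_scaledKernel_up (hε : 0 < ε) (hq : 0 ≤ q)
    (hup : ENNReal.ofReal q ≤ ν (Set.Icc ε ε⁻¹)) {a : ℝ} (ha : 0 ≤ a) (n : ℕ) :
    ENNReal.ofReal (q ^ n * Real.exp (a * ε * (n * (n - 1) / 2))) ≤
      (scaledKernel (rwKernel ν) (expWeight a) (measurable_expWeight a) ^ n) 0
        {y : ℝ≥0 | n * ε ≤ (y : ℝ) ∧ (y : ℝ) ≤ n * ε⁻¹} := by
  induction n with
  | zero => rw [pow_zero_apply, Measure.dirac_apply_of_mem (by simp)]; simp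
  | succ n ih =>
    have hB : ∀ n : ℕ, MeasurableSet {y : ℝ≥0 | n * ε ≤ (y : ℝ) ∧ (y : ℝ) ≤ n * ε⁻¹} := by
      intro n; measurability
    -- The weight is read at the departure point, whose height is at least nε. The exponents 0, 1,
    -- …, n - 1 add up to n(n - 1)/2.
    refine le_trans ?_ (mul_pow_apply_le _ (c := ENNReal.ofReal (Real.exp (a * ε * n) * q))
      (hB (n + 1)) (hB n) fun y hy => ?_)
    · refine le_trans (le_of_eq ?_) (mul_le_mul_right ih _)
      rw [← ENNReal.ofReal_mul (by positivity)]
      congr 1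
      have : a * ε * (((n + 1 : ℕ) : ℝ) * (((n + 1 : ℕ) : ℝ) - 1) / 2)
          = a * ε * n + a * ε * (n * (n - 1) / 2) := by push_cast; ring
      rw [this, Real.exp_add]; ring
    · rw [pow_one]
      change _ ≤ ((expWeight a y : ℝ≥0∞) • rwKernel ν y) _
      rw [Measure.smul_apply, smul_eq_mul, rwKernel_apply' _ _ (hB _),
        ENNReal.ofReal_mul (by positivity)]
      refine mul_le_mul' ?_ (hup.trans (measure_mono fun d hd => ?_))
      · refine ENNReal.ofReal_le_ofReal (Real.exp_le_exp.2 ?_)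
        rw [mul_assoc, mul_comm ε]
        exact mul_le_mul_of_nonneg_left hy.1 ha
      · simp only [Set.mem_preimage, Set.mem_ofPred_eq, Set.mem_Icc] at hd hy ⊢
        rw [Real.coe_toNNReal _ (by linarith [y.2])]
        push_cast
        constructor <;> linarith

theorem one_le_expWeight {a : ℝ} (ha : 0 ≤ a) (x : ℝ≥0) : 1 ≤ expWeight a x := by
  rw [expWeight, Real.one_le_toNNReal]
  exact Real.one_le_exp (by positivity)

/-- The bound is uniform in the starting point, so that it can be integrated against an invariant
law. -/
theorem ofReal_pow_le_pow_apply_Ici (hε : 0 < ε) (hq : 0 ≤ q)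
    (hup : ENNReal.ofReal q ≤ ν (Set.Icc ε ε⁻¹)) (n : ℕ) (x : ℝ≥0) :
    ENNReal.ofReal (q ^ n) ≤ (rwKernel ν ^ n) x {y : ℝ≥0 | n * ε ≤ (y : ℝ)} := by
  induction n with
  | zero => rw [pow_zero_apply]; simp
  | succ n ih =>
    have hB : ∀ n : ℕ, MeasurableSet {y : ℝ≥0 | n * ε ≤ (y : ℝ)} := by
      intro n; measurability
    refine le_trans ?_ (mul_pow_apply_le _ (c := ENNReal.ofReal q) (hB (n + 1)) (hB n)
      fun y hy => ?_)
    · rw [pow_succ', ENNReal.ofReal_mul hq]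
      gcongr
    · rw [pow_one, rwKernel_apply' _ _ (hB _)]
      refine hup.trans (measure_mono fun d hd => ?_)
      simp only [Set.mem_preimage, Set.mem_ofPred_eq, Set.mem_Icc] at hd hy ⊢
      rw [Real.coe_toNNReal _ (by linarith [y.2])]
      push_cast
      linarith

end Kernel

end RRW

/-! ### Superexponential growth of the weighted semigroup -/

namespace RRW

/-- Of `m` steps, n = m / (N + 1) go up and the others come down. As m ≤ (N + 1)(n + 1), a quadratic
in n beats any linear function of m. -/
theorem eventually_mul_le_quadratic {b c : ℝ} (hc : 0 < c) (N : ℕ) :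
    ∀ᶠ m : ℕ in atTop,
      b * m ≤ c * (((m / (N + 1) : ℕ) : ℝ) * (((m / (N + 1) : ℕ) : ℝ) - 1) / 2) := by
  obtain ⟨K, hK⟩ := exists_nat_ge (4 * |b| * (N + 1) / c + 1)
  filter_upwards [eventually_ge_atTop ((K + 1) * (N + 1))] with m hm
  have h1 : K + 1 ≤ m / (N + 1) := (Nat.le_div_iff_mul_le (Nat.succ_pos N)).2 hm
  have h2 : m < (N + 1) * (m / (N + 1) + 1) := by
    rw [mul_comm]; exact Nat.lt_mul_of_div_lt (Nat.lt_succ_self _) (Nat.succ_pos N)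
  generalize m / (N + 1) = n at h1 h2
  have h1' : (K : ℝ) + 1 ≤ n := by exact_mod_cast h1
  have h2' : (m : ℝ) ≤ (N + 1) * (n + 1) := by exact_mod_cast h2.le
  have hK0 : (0 : ℝ) ≤ K := Nat.cast_nonneg K
  have h3 : 4 * |b| * (N + 1) ≤ c * (n - 1) := by
    have : 4 * |b| * (N + 1) / c ≤ n - 1 := by linarith
    rw [div_le_iff₀ hc] at this
    linarith
  calc b * m ≤ |b| * ((N + 1) * (n + 1)) :=
        mul_le_mul (le_abs_self b) h2' (Nat.cast_nonneg m) (abs_nonneg b)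
    _ ≤ |b| * ((N + 1) * (2 * n)) := by gcongr; linarith
    _ = (4 * |b| * (N + 1)) * (n / 2) := by ring
    _ ≤ c * (n - 1) * (n / 2) := by gcongr
    _ = _ := by ring

theorem eventually_exp_le_pow_scaledKernel {ν : Measure ℝ} [IsProbabilityMeasure ν] {ε q : ℝ}
    (hε : 0 < ε) (hq : 0 < q) (hup : ENNReal.ofReal q ≤ ν (Set.Icc ε ε⁻¹))
    (hdown : ENNReal.ofReal q ≤ ν (Set.Iic (-ε))) {a : ℝ} (ha : 0 < a) (B : ℝ) :
    ∀ᶠ m : ℕ in atTop, ENNReal.ofReal (Real.exp (B * m)) ≤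
      (scaledKernel (rwKernel ν) (expWeight a) (measurable_expWeight a) ^ m) 0 {0} := by
  -- `N` downward moves undo one upward move, whose size is at most ε⁻¹.
  obtain ⟨N, hN⟩ := exists_nat_ge (ε⁻¹ / ε)
  rw [div_le_iff₀ hε] at hN
  -- All m moves together cost q ^ m = exp(m log q), which is absorbed into the linear rate.
  filter_upwards [eventually_mul_le_quadratic (b := B - Real.log q) (mul_pos ha hε) N] with m hm
  have hn : m / (N + 1) * (N + 1) ≤ m := Nat.div_mul_le_self _ _
  generalize m / (N + 1) = n at hm hn
  obtain ⟨k, rfl⟩ : ∃ k, m = n + k := Nat.exists_eq_add_of_le (by nlinarith)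
  have hk : n * N ≤ k := by nlinarith
  have hk' : (n : ℝ) * N ≤ k := by exact_mod_cast hk
  have h := mul_pow_apply_le (scaledKernel (rwKernel ν) (expWeight a) (measurable_expWeight a))
    (x := 0) (n := n) (m := k) (c := ENNReal.ofReal (q ^ k))
    (B := {y : ℝ≥0 | n * ε ≤ (y : ℝ) ∧ (y : ℝ) ≤ n * ε⁻¹}) (measurableSet_singleton 0)
    (by measurability) (fun y hy => ?_)
  · refine le_trans ?_ h
    refine le_trans ?_ (mul_le_mul_right (ofReal_le_pow_scaledKernel_up hε hq.le hup ha.le n) _)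
    rw [← ENNReal.ofReal_mul (by positivity)]
    refine ENNReal.ofReal_le_ofReal ?_
    have hqe : ∀ j : ℕ, q ^ j = Real.exp (Real.log q * j) := fun j => by
      rw [← Real.rpow_natCast, Real.rpow_def_of_pos hq]
    rw [hqe, hqe, ← Real.exp_add, ← Real.exp_add]
    refine Real.exp_le_exp.2 ?_
    push_cast at hm ⊢
    linarith
  · refine le_trans (ofReal_pow_le_pow_apply_zero hq.le hdown k y (hy.2.trans ?_))
      (Measure.le_iff.1 (pow_le_pow_scaledKernel _ (measurable_expWeight a)
        (one_le_expWeight ha.le) k y) _ (measurableSet_singleton 0))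
    calc n * ε⁻¹ ≤ n * (N * ε) := by gcongr
      _ = n * N * ε := by ring
      _ ≤ k * ε := by gcongr

theorem tendsto_log_div_top {u : ℕ → ℝ≥0∞}
    (h : ∀ B : ℝ, ∀ᶠ n : ℕ in atTop, ENNReal.ofReal (Real.exp (B * n)) ≤ u n) :
    Tendsto (fun n : ℕ => ENNReal.log (u n) / ((n : ℝ) : EReal)) atTop (𝓝 ⊤) := by
  rw [EReal.tendsto_nhds_top_iff_real]
  intro B
  filter_upwards [h (B + 1), eventually_gt_atTop 0] with n hn h0
  have hn0 : (0 : ℝ) < n := by exact_mod_cast h0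
  refine lt_of_lt_of_le (b := ((B + 1 : ℝ) : EReal)) (by exact_mod_cast lt_add_one B) ?_
  rw [EReal.le_div_iff_mul_le (by exact_mod_cast hn0) (EReal.coe_ne_top _), ← EReal.coe_mul]
  rw [← ENNReal.log_le_log_iff, ENNReal.log_ofReal_of_pos (Real.exp_pos _), Real.log_exp] at hn
  exact hn

theorem exists_measure_le_ne_zero (ν₀ : Measure ℝ≥0) [IsProbabilityMeasure ν₀] {ε : ℝ}
    (hε : 0 < ε) : ∃ j : ℕ, ν₀ {x : ℝ≥0 | (x : ℝ) ≤ j * ε} ≠ 0 := by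
  by_contra! h
  have hU : (⋃ j : ℕ, {x : ℝ≥0 | (x : ℝ) ≤ j * ε}) = Set.univ := by
    refine Set.eq_univ_of_forall fun x => Set.mem_iUnion.2 ?_
    obtain ⟨j, hj⟩ := exists_nat_ge ((x : ℝ) / ε)
    exact ⟨j, by rwa [div_le_iff₀ hε] at hj⟩
  have := measure_iUnion_null h
  rw [hU, measure_univ] at this
  exact one_ne_zero this

theorem isGPE_top_of_tendsto {ν : Measure ℝ} [IsProbabilityMeasure ν]
    (hpos : 0 < ν (Set.Ioi 0)) (hneg : 0 < ν (Set.Iio 0)) {π : Measure ℝ≥0}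
    (hπ : ∀ x A, MeasurableSet A → Tendsto (fun n => (rwKernel ν ^ n) x A) atTop (𝓝 (π A)))
    (hπ0 : 0 < π {0}) {a : ℝ} (ha : 0 < a) :
    IsGPE (scaledKernel (rwKernel ν) (expWeight a) (measurable_expWeight a)) π ∞ := by
  obtain ⟨ε, q, hε, hq, -, hup, hdown⟩ := exists_scale ν hpos hneg
  set Q := scaledKernel (rwKernel ν) (expWeight a) (measurable_expWeight a) with hQ
  have hPQ : ∀ n x, (rwKernel ν ^ n) x ≤ (Q ^ n) x :=
    pow_le_pow_scaledKernel _ (measurable_expWeight a) (one_le_expWeight ha.le)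
  have hPpos : ∀ x A, MeasurableSet A → 0 < π A → ∀ᶠ n : ℕ in atTop, 0 < (rwKernel ν ^ n) x A :=
    fun x A hA h => (hπ x A hA).eventually (lt_mem_nhds h)
  have hap : IsAperiodic Q π := fun x A hA h =>
    (hPpos x A hA h).mono fun n hn => hn.trans_le (Measure.le_iff.1 (hPQ n x) A hA)
  refine ⟨⟨fun A hA h x => (hap x A hA h).exists⟩, hap, ?_, ⊤, EReal.exp_top.symm, ?_⟩
  · have hm : MeasurableSet ({0} : Set ℝ≥0) := measurableSet_singleton 0
    refine ⟨({0} : Set ℝ≥0).indicator fun _ => (q ^ 1).toNNReal, Measure.dirac 0,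
      ⟨measurable_const.indicator hm, inferInstance, 1, le_rfl, fun x A hA => ?_⟩, ?_⟩
    · by_cases hx : x ∈ ({0} : Set ℝ≥0)
      · rw [Set.indicator_of_mem hx]
        by_cases h0 : (0 : ℝ≥0) ∈ A
        · simp only [Measure.dirac_apply' _ hA, Set.indicator_of_mem h0, Pi.one_apply, mul_one]
          refine (ofReal_pow_le_pow_apply_zero hq.le hdown 1 x ?_).trans
            ((Measure.le_iff.1 (hPQ 1 x) _ hm).trans (measure_mono (by simpa using h0)))
          rw [Set.mem_singleton_iff.1 hx]; simpa using hε.le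
        · simp [Measure.dirac_apply' _ hA, h0]
      · rw [Set.indicator_of_notMem hx]; simp
    · have : (fun x : ℝ≥0 => ((({0} : Set ℝ≥0).indicator (fun _ => (q ^ 1).toNNReal) x : ℝ≥0) : ℝ≥0∞))
          = ({0} : Set ℝ≥0).indicator fun _ => ENNReal.ofReal (q ^ 1) := by
        ext x; by_cases hx : x = 0 <;> simp [hx, ENNReal.ofReal]
      rw [this, lintegral_indicator_const hm]
      exact ENNReal.mul_pos (by simpa using hq) hπ0.ne'
  · rintro s ν₀ ⟨hs, hν₀, -⟩ hs0
    refine tendsto_log_div_top fun B => ?_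
    have hs' : Measurable fun y => (s y : ℝ≥0∞) := hs.coe_nnreal_ennreal
    -- from the origin, `s` is charged at some time `k`
    obtain ⟨k, hk⟩ : ∃ k, 0 < ∫⁻ y, (s y : ℝ≥0∞) ∂((Q ^ k) 0) := by
      have hsupp : 0 < π (Function.support fun y => (s y : ℝ≥0∞)) :=
        (lintegral_pos_iff_support hs').1 hs0
      obtain ⟨k, hk⟩ := (hap 0 _ (measurableSet_support hs') hsupp).exists
      exact ⟨k, (lintegral_pos_iff_support hs').2 hk⟩
    -- from `ν₀`, the origin is reached at some time `j`
    obtain ⟨j, hj⟩ := exists_measure_le_ne_zero ν₀ hε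
    have hB : MeasurableSet {x : ℝ≥0 | (x : ℝ) ≤ j * ε} := by measurability
    -- The price, independent of `m`, of entering the origin from `ν₀` and leaving it towards `s`.
    set c := ENNReal.ofReal (q ^ j) * (∫⁻ y, (s y : ℝ≥0∞) ∂((Q ^ k) 0)) *
      ν₀ {x : ℝ≥0 | (x : ℝ) ≤ j * ε} with hc
    have hc0 : c ≠ 0 := mul_ne_zero (mul_ne_zero (by simpa using pow_pos hq j) hk.ne') hj
    have hlow : ∀ m, (Q ^ m) 0 {0} * c ≤
        ∫⁻ x, ∫⁻ y, (s y : ℝ≥0∞) ∂((Q ^ (j + m + k)) x) ∂ν₀ := by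
      intro m
      have h1 : ∀ x : ℝ≥0, (x : ℝ) ≤ j * ε →
          (Q ^ m) 0 {0} * (ENNReal.ofReal (q ^ j) * ∫⁻ y, (s y : ℝ≥0∞) ∂((Q ^ k) 0)) ≤
            ∫⁻ y, (s y : ℝ≥0∞) ∂((Q ^ (j + m + k)) x) := by
        intro x hx
        rw [lintegral_pow_add Q k (j + m) x hs']
        calc _ = (∫⁻ y, (s y : ℝ≥0∞) ∂((Q ^ k) 0)) * ((Q ^ m) 0 {0} * ENNReal.ofReal (q ^ j)) := by
              ring
          _ ≤ (∫⁻ y, (s y : ℝ≥0∞) ∂((Q ^ k) 0)) * (Q ^ (j + m)) x {0} := by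
              gcongr
              refine le_trans ?_ (mul_pow_apply_le Q (n := j) (c := (Q ^ m) 0 {0})
                (measurableSet_singleton 0) (measurableSet_singleton 0) (by simp))
              gcongr
              exact (ofReal_pow_le_pow_apply_zero hq.le hdown j x hx).trans
                (Measure.le_iff.1 (hPQ j x) _ (measurableSet_singleton 0))
          _ = ∫⁻ y in {0}, (∫⁻ z, (s z : ℝ≥0∞) ∂((Q ^ k) y)) ∂((Q ^ (j + m)) x) := by
              rw [lintegral_singleton]
          _ ≤ _ := setLIntegral_le_lintegral _ _
      rw [hc, ← mul_assoc, ← lintegral_indicator_const hB]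
      refine lintegral_mono fun x => ?_
      by_cases hx : x ∈ {x : ℝ≥0 | (x : ℝ) ≤ j * ε}
      · simpa only [Set.indicator_of_mem hx] using h1 x hx
      · simp only [Set.indicator_of_notMem hx]; exact zero_le
    -- The integral in `c` may be infinite; a finite positive minorant has a real logarithm.
    obtain ⟨c', hc', hc'c⟩ := ENNReal.lt_iff_exists_nnreal_btwn.1 (pos_iff_ne_zero.2 hc0)
    have hc'0 : (0 : ℝ) < c' := by exact_mod_cast hc'
    -- The surplus eᵐ from the rate B + 1 pays for `c'` and for the `j + k` additional steps.
    obtain ⟨m₀, hm₀⟩ := eventually_atTop.1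
      (eventually_exp_le_pow_scaledKernel hε hq hup hdown ha (B + 1))
    obtain ⟨m₁, hm₁⟩ := exists_nat_ge (B * (j + k) - Real.log c')
    filter_upwards [eventually_ge_atTop (j + (m₀ + m₁) + k)] with n hn
    obtain ⟨m, rfl⟩ : ∃ m, n = j + m + k := ⟨n - j - k, by omega⟩
    refine le_trans ?_ (hlow m)
    refine le_trans ?_ (mul_le_mul' (hm₀ m (by omega)) hc'c.le)
    rw [← ENNReal.ofReal_coe_nnreal, ← ENNReal.ofReal_mul (Real.exp_pos _).le]
    refine ENNReal.ofReal_le_ofReal ?_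
    rw [← Real.exp_log hc'0, ← Real.exp_add]
    refine Real.exp_le_exp.2 ?_
    have : (m₁ : ℝ) ≤ m := by exact_mod_cast (by omega : m₁ ≤ m)
    push_cast
    linarith

end RRW

namespace RRW

/-! ### Drift of the quadratic Lyapunov function -/

section Drift

variable {ν : Measure ℝ} [IsProbabilityMeasure ν] {δ : ℝ}

theorem measurable_lyapunov (δ : ℝ) : Measurable (lyapunov δ) := by
  unfold lyapunov; fun_prop

theorem lyapunov_nonneg (hδ : 0 < δ) (x : ℝ≥0) : 0 ≤ lyapunov δ x := by
  unfold lyapunov; positivity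

/-- The effect of the reflection at the origin on the Lyapunov function. -/
theorem abs_lyapunov_step_sub_le (hδ : 0 < δ) (x : ℝ≥0) (d : ℝ) :
    |lyapunov δ ((x : ℝ) + d).toNNReal
        - (lyapunov δ x + 1 / 2 * δ⁻¹ * ((2 * x + δ) * d + d ^ 2))|
      ≤ 1 / 2 * δ⁻¹ * (d ^ 2 + δ * |d|) := by
  have hx : (0 : ℝ) ≤ x := x.2
  unfold lyapunov
  by_cases h : 0 ≤ (x : ℝ) + d
  · rw [Real.coe_toNNReal _ h]
    have : 1 + 1 / 2 * δ⁻¹ * (((x : ℝ) + d) ^ 2 + δ * (x + d))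
        - (1 + 1 / 2 * δ⁻¹ * ((x : ℝ) ^ 2 + δ * x) + 1 / 2 * δ⁻¹ * ((2 * x + δ) * d + d ^ 2)) = 0 := by
      ring
    rw [this, abs_zero]
    positivity
  -- Reflection moves x + d, which lies in [d, 0), to 0; the correction is therefore bounded through
  -- |d| alone.
  · push Not at h
    rw [Real.toNNReal_of_nonpos h.le]
    have hd : |d| = -d := abs_of_neg (by linarith)
    have : 1 + 1 / 2 * δ⁻¹ * (((0 : ℝ≥0) : ℝ) ^ 2 + δ * ((0 : ℝ≥0) : ℝ))
        - (1 + 1 / 2 * δ⁻¹ * ((x : ℝ) ^ 2 + δ * x) + 1 / 2 * δ⁻¹ * ((2 * x + δ) * d + d ^ 2))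
        = 1 / 2 * δ⁻¹ * (δ * (-(x + d)) - (x + d) ^ 2) := by
      push_cast; ring
    rw [this, abs_mul, abs_of_pos (by positivity : 0 < 1 / 2 * δ⁻¹), hd]
    gcongr
    rw [abs_le]
    have h1 : 0 ≤ δ * x := by positivity
    have h2 : 0 ≤ δ * (-(x + d)) := mul_nonneg hδ.le (by linarith)
    have h3 : (x + d) ^ 2 ≤ d ^ 2 := by
      nlinarith [mul_nonneg hx (by linarith : 0 ≤ -(x + d) - d)]
    constructor <;> nlinarith [sq_nonneg ((x : ℝ) + d)]

theorem integrable_lyapunov_step (hδ : 0 < δ) (hd : Integrable (fun d : ℝ => d) ν)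
    (hd2 : Integrable (fun d : ℝ => d ^ 2) ν) (x : ℝ≥0) :
    Integrable (fun d : ℝ => lyapunov δ ((x : ℝ) + d).toNNReal) ν := by
  have h1 : Integrable (fun d : ℝ =>
      lyapunov δ x + 1 / 2 * δ⁻¹ * ((2 * x + δ) * d + d ^ 2)) ν :=
    (integrable_const _).add (((hd.const_mul _).add hd2).const_mul _)
  have h2 : Integrable (fun d : ℝ => lyapunov δ ((x : ℝ) + d).toNNReal
        - (lyapunov δ x + 1 / 2 * δ⁻¹ * ((2 * x + δ) * d + d ^ 2))) ν := by
    refine Integrable.mono' (((hd2.add (hd.abs.const_mul δ)).const_mul (1 / 2 * δ⁻¹)))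
      ?_ (ae_of_all _ fun d => abs_lyapunov_step_sub_le hδ x d)
    exact (((measurable_lyapunov δ).comp (measurable_step x)).sub
      (by fun_prop)).aestronglyMeasurable
  exact (h2.add h1).congr (ae_of_all _ fun d => by simp)

theorem integrable_lyapunov (hδ : 0 < δ) (hd : Integrable (fun d : ℝ => d) ν)
    (hd2 : Integrable (fun d : ℝ => d ^ 2) ν) (x : ℝ≥0) :
    Integrable (lyapunov δ) (rwKernel ν x) := by
  rw [rwKernel_apply, integrable_map_measure (measurable_lyapunov δ).aestronglyMeasurable
    (measurable_step x).aemeasurable]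
  exact integrable_lyapunov_step hδ hd hd2 x

/-- The unreflected drift is exactly -x + (E d² - δ²)/(2δ), and the reflection error has an
integrable bound free of x. -/
theorem exists_bound_integral_lyapunov (hδ : 0 < δ) (hd : Integrable (fun d : ℝ => d) ν)
    (hd2 : Integrable (fun d : ℝ => d ^ 2) ν) (hmean : ∫ d, d ∂ν = -δ) :
    ∃ B : ℝ, ∀ x : ℝ≥0,
      |∫ y, lyapunov δ y ∂(rwKernel ν x) - lyapunov δ x + x| ≤ B := by
  refine ⟨1 / 2 * δ⁻¹ * (∫ d, d ^ 2 ∂ν + δ * ∫ d, |d| ∂ν)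
    + |1 / 2 * δ⁻¹ * (∫ d, d ^ 2 ∂ν - δ ^ 2)|, fun x => ?_⟩
  have h1 : Integrable (fun d : ℝ =>
      lyapunov δ x + 1 / 2 * δ⁻¹ * ((2 * x + δ) * d + d ^ 2)) ν :=
    (integrable_const _).add (((hd.const_mul _).add hd2).const_mul _)
  have h2 : Integrable (fun d : ℝ => (2 * x + δ) * d + d ^ 2) ν := (hd.const_mul _).add hd2
  have e1 : ∫ d : ℝ, (lyapunov δ x + 1 / 2 * δ⁻¹ * ((2 * x + δ) * d + d ^ 2)) ∂ν
      = lyapunov δ x - x + 1 / 2 * δ⁻¹ * (∫ d, d ^ 2 ∂ν - δ ^ 2) := by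
    rw [integral_add (integrable_const _) (h2.const_mul _), integral_const, integral_const_mul,
      integral_add (hd.const_mul _) hd2, integral_const_mul, hmean]
    simp only [probReal_univ, one_smul]
    field_simp
    ring
  rw [rwKernel_apply, integral_map (measurable_step x).aemeasurable
    (measurable_lyapunov δ).aestronglyMeasurable]
  have e2 := integral_sub (integrable_lyapunov_step hδ hd hd2 x) h1
  have e3 : |∫ d : ℝ, (lyapunov δ ((x : ℝ) + d).toNNReal
        - (lyapunov δ x + 1 / 2 * δ⁻¹ * ((2 * x + δ) * d + d ^ 2))) ∂ν|
      ≤ 1 / 2 * δ⁻¹ * (∫ d, d ^ 2 ∂ν + δ * ∫ d, |d| ∂ν) := by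
    have e4 : ∫ d, 1 / 2 * δ⁻¹ * (d ^ 2 + δ * |d|) ∂ν
        = 1 / 2 * δ⁻¹ * (∫ d, d ^ 2 ∂ν + δ * ∫ d, |d| ∂ν) := by
      rw [integral_const_mul, integral_add hd2 (hd.abs.const_mul δ), integral_const_mul]
    rw [← e4, ← Real.norm_eq_abs]
    have hg : Integrable (fun d : ℝ => 1 / 2 * δ⁻¹ * (d ^ 2 + δ * |d|)) ν :=
      (hd2.add (hd.abs.const_mul δ)).const_mul _
    exact norm_integral_le_of_norm_le hg
      (ae_of_all _ fun d => abs_lyapunov_step_sub_le hδ x d)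
  rw [e2, e1] at e3
  refine le_trans (le_of_eq ?_) ((abs_add_le _ _).trans (add_le_add_left e3 _))
  congr 1
  ring

theorem driftV3_lyapunov (hδ : 0 < δ) (hd : Integrable (fun d : ℝ => d) ν)
    (hd2 : Integrable (fun d : ℝ => d ^ 2) ν) (hmean : ∫ d, d ∂ν = -δ) {ε q : ℝ} (hε : 0 < ε)
    (hq : 0 < q) (hdown : ENNReal.ofReal q ≤ ν (Set.Iic (-ε))) :
    DriftV3 (rwKernel ν) (fun x => ENNReal.ofReal (lyapunov δ x))
      (fun x => 1 + 1 / 2 * (x : ℝ)) := by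
  obtain ⟨B, hB⟩ := exists_bound_integral_lyapunov hδ hd hd2 hmean
  have hB0 : 0 ≤ B := (abs_nonneg _).trans (hB 0)
  refine ⟨(measurable_lyapunov δ).ennreal_ofReal, by fun_prop,
    fun x => by change 1 ≤ 1 + 1 / 2 * (x : ℝ); linarith [NNReal.coe_nonneg x],
    -- Beyond 2(B + 1) one has x - B ≥ 1 + x/2; below it, adding B + 1 makes up the difference.
    {x : ℝ≥0 | (x : ℝ) ≤ 2 * (B + 1)}, isSmallSet_Iic hε hq hdown _, (B + 1).toNNReal,
    fun x _ => ?_⟩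
  have hx : (0 : ℝ) ≤ x := x.2
  rw [← ofReal_integral_eq_lintegral_ofReal (integrable_lyapunov hδ hd hd2 x)
    (ae_of_all _ fun y => lyapunov_nonneg hδ y),
    ← ENNReal.ofReal_add (integral_nonneg fun y => lyapunov_nonneg hδ y) (by positivity)]
  have hb := (abs_le.1 (hB x)).2
  by_cases hxC : x ∈ {x : ℝ≥0 | (x : ℝ) ≤ 2 * (B + 1)}
  · rw [Set.indicator_of_mem hxC]
    change _ ≤ _ + ENNReal.ofReal (B + 1)
    rw [← ENNReal.ofReal_add (lyapunov_nonneg hδ x) (by positivity)]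
    exact ENNReal.ofReal_le_ofReal (by linarith)
  · rw [Set.indicator_of_notMem hxC, add_zero]
    simp only [Set.mem_ofPred_eq, not_le] at hxC
    exact ENNReal.ofReal_le_ofReal (by linarith)

end Drift

end RRW

namespace RRW

/-! ### Integrating out the next increment -/

section Past

variable {Ω : Type*}

/-- The `σ`-algebra generated by the first `k` increments. -/
@[reducible] def pastSigma (D : ℕ → Ω → ℝ) (k : ℕ) : MeasurableSpace Ω :=
  ⨆ i ∈ {i : ℕ | i < k}, MeasurableSpace.comap (D i) inferInstance

theorem pastSigma_mono (D : ℕ → Ω → ℝ) {k l : ℕ} (h : k ≤ l) : pastSigma D k ≤ pastSigma D l :=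
  biSup_mono fun _ hi => lt_of_lt_of_le hi h

theorem measurable_pastSigma_of_lt (D : ℕ → Ω → ℝ) {i k : ℕ} (h : i < k) :
    Measurable[pastSigma D k] (D i) :=
  measurable_iff_comap_le.2 (le_biSup (fun i => MeasurableSpace.comap (D i) inferInstance) h)

variable [MeasurableSpace Ω] {μ : Measure Ω} [IsProbabilityMeasure μ] {D : ℕ → Ω → ℝ}

theorem pastSigma_le (hmeas : ∀ k, Measurable (D k)) (k : ℕ) :
    pastSigma D k ≤ (inferInstance : MeasurableSpace Ω) :=
  iSup₂_le fun i _ => (hmeas i).comap_le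

/-- Integrating out the increment of step `k` against a functional of the earlier increments. -/
theorem lintegral_past_eq {β : Type*} [MeasurableSpace β] (hmeas : ∀ k, Measurable (D k))
    (hindep : iIndepFun D μ) (hident : ∀ k, IdentDistrib (D k) (D 0) μ μ) {k : ℕ} {Y : Ω → β}
    (hY : Measurable[pastSigma D k] Y) {F : β × ℝ → ℝ≥0∞} (hF : Measurable F) :
    ∫⁻ ω, F (Y ω, D k ω) ∂μ = ∫⁻ ω, ∫⁻ d, F (Y ω, d) ∂(μ.map (D 0)) ∂μ := by
  have hY' : Measurable Y := hY.mono (pastSigma_le hmeas k) le_rfl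
  have h1 : Indep (pastSigma D k) (⨆ i ∈ ({k} : Set ℕ), MeasurableSpace.comap (D i) inferInstance)
      μ := indep_iSup_of_disjoint (fun i => (hmeas i).comap_le) hindep
        (Set.disjoint_singleton_right.2 (by simp))
  rw [iSup_singleton] at h1
  have h2 : IndepFun Y (D k) μ := indep_of_indep_of_le_left h1 hY.comap_le
  have h3 := (indepFun_iff_map_prod_eq_prod_map_map hY'.aemeasurable (hmeas k).aemeasurable).1 h2
  rw [← lintegral_map (f := F) (g := fun ω => (Y ω, D k ω)) hF (hY'.prodMk (hmeas k)), h3,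
    lintegral_prod _ hF.aemeasurable, lintegral_map hF.lintegral_prod_right' hY',
    (hident k).map_eq]

end Past

/-! ### Comparison principles for the killed operator -/

section KilledOperator

variable (ν : Measure ℝ) [IsProbabilityMeasure ν]

/-- The transition operator of the walk killed at the origin. -/
noncomputable def killedOp (f : ℝ≥0 → ℝ≥0∞) (x : ℝ≥0) : ℝ≥0∞ :=
  ∫⁻ y, ({0}ᶜ : Set ℝ≥0).indicator f y ∂(rwKernel ν x)

variable {ν} {f g w : ℝ≥0 → ℝ≥0∞}

theorem measurable_indicator_compl_zero (hf : Measurable f) :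
    Measurable (({0}ᶜ : Set ℝ≥0).indicator f) :=
  hf.indicator (measurableSet_singleton 0).compl

theorem measurable_killedOp (hf : Measurable f) : Measurable (killedOp ν f) :=
  (measurable_indicator_compl_zero hf).lintegral_kernel

theorem measurable_killedOp_iterate (hf : Measurable f) (n : ℕ) :
    Measurable ((killedOp ν)^[n] f) := by
  induction n with
  | zero => exact hf
  | succ n ih => rw [Function.iterate_succ_apply']; exact measurable_killedOp ih

theorem killedOp_eq (hf : Measurable f) (x : ℝ≥0) :
    killedOp ν f x = ∫⁻ d, ({0}ᶜ : Set ℝ≥0).indicator f ((x : ℝ) + d).toNNReal ∂ν :=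
  lintegral_rwKernel ν x (measurable_indicator_compl_zero hf)

theorem killedOp_mono : Monotone (killedOp ν) := fun _ _ h _ =>
  lintegral_mono fun y => Set.indicator_le_indicator (h y)

theorem killedOp_add (hf : Measurable f) : killedOp ν (f + g) = killedOp ν f + killedOp ν g := by
  ext x
  simp only [killedOp, Set.indicator_add', Pi.add_apply]
  exact lintegral_add_left (measurable_indicator_compl_zero hf) _

theorem killedOp_const_mul (hf : Measurable f) (c : ℝ≥0∞) :
    killedOp ν (fun x => c * f x) = fun x => c * killedOp ν f x := by
  ext x
  simp only [killedOp]
  rw [← lintegral_const_mul _ (measurable_indicator_compl_zero hf)]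
  congr 1
  ext y
  by_cases hy : y ∈ ({0}ᶜ : Set ℝ≥0)
  · simp only [Set.indicator_of_mem hy]
  · simp only [Set.indicator_of_notMem hy, mul_zero]

theorem killedOp_iterate_const_mul (hf : Measurable f) (c : ℝ≥0∞) (n : ℕ) :
    (killedOp ν)^[n] (fun x => c * f x) = fun x => c * (killedOp ν)^[n] f x := by
  induction n with
  | zero => rfl
  | succ n ih =>
    rw [Function.iterate_succ_apply', ih, killedOp_const_mul (measurable_killedOp_iterate hf n),
      Function.iterate_succ_apply']

theorem measurable_sum_iterate_killedOp (hf : Measurable f) (n : ℕ) :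
    Measurable (∑ k ∈ Finset.range n, (killedOp ν)^[k] f) :=
  Finset.sum_induction _ Measurable (fun _ _ => Measurable.add) measurable_zero
    fun k _ => measurable_killedOp_iterate hf k

theorem sum_iterate_killedOp_succ (hf : Measurable f) (n : ℕ) :
    ∑ k ∈ Finset.range (n + 1), (killedOp ν)^[k] f
      = f + killedOp ν (∑ k ∈ Finset.range n, (killedOp ν)^[k] f) := by
  induction n with
  | zero =>
    have : killedOp ν (0 : ℝ≥0 → ℝ≥0∞) = 0 := by ext x; simp [killedOp]
    simp [this]
  | succ n ih =>
    conv_lhs => rw [Finset.sum_range_succ, ih, Function.iterate_succ_apply', add_assoc,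
      ← killedOp_add (measurable_sum_iterate_killedOp hf n),
      ← Finset.sum_range_succ]

/-- Comparison with a supersolution. -/
theorem tsum_iterate_killedOp_le (hf : Measurable f) (h : f + killedOp ν w ≤ w) (x : ℝ≥0) :
    ∑' k, (killedOp ν)^[k] f x ≤ w x := by
  have key : ∀ n, ∑ k ∈ Finset.range n, (killedOp ν)^[k] f ≤ w := by
    intro n
    induction n with
    | zero => simp
    | succ n ih =>
      rw [sum_iterate_killedOp_succ hf]
      exact (add_le_add_right (killedOp_mono ih) f).trans h
  refine ENNReal.tsum_le_of_sum_range_le fun n => ?_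
  simpa using key n x

/-- Comparison with a subsolution. -/
theorem le_sum_iterate_killedOp_add (hf : Measurable f)
    (h : w ≤ f + killedOp ν w) (n : ℕ) :
    w ≤ ∑ k ∈ Finset.range n, (killedOp ν)^[k] f + (killedOp ν)^[n] w := by
  induction n with
  | zero => simp
  | succ n ih =>
    rw [sum_iterate_killedOp_succ hf, Function.iterate_succ_apply', add_assoc, ← killedOp_add]
    · exact h.trans (add_le_add_right (killedOp_mono ih) f)
    · exact measurable_sum_iterate_killedOp hf n

/-- The remainder Kⁿw vanishes, being at most `c` times the general term of the convergent series
for `g`. -/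
theorem le_tsum_iterate_killedOp (hf : Measurable f) (hg : Measurable g)
    (h : w ≤ f + killedOp ν w) {c : ℝ≥0∞} (hc : c ≠ ∞) (hwg : ∀ x, w x ≤ c * g x) (x : ℝ≥0)
    (hgx : ∑' k, (killedOp ν)^[k] g x ≠ ∞) :
    w x ≤ ∑' k, (killedOp ν)^[k] f x := by
  have h0 : Tendsto (fun n => ∑' k, (killedOp ν)^[k] f x + c * (killedOp ν)^[n] g x) atTop
      (𝓝 (∑' k, (killedOp ν)^[k] f x + c * 0)) :=
    tendsto_const_nhds.add
      (ENNReal.Tendsto.const_mul (ENNReal.tendsto_atTop_zero_of_tsum_ne_top hgx) (Or.inr hc))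
  rw [mul_zero, add_zero] at h0
  refine ge_of_tendsto' h0 fun n => ?_
  refine (le_sum_iterate_killedOp_add hf h n x).trans ?_
  rw [Pi.add_apply, Finset.sum_apply]
  refine add_le_add (ENNReal.sum_le_tsum (f := fun k => (killedOp ν)^[k] f x) _) ?_
  have := (killedOp_mono (ν := ν)).iterate n (show w ≤ fun x => c * g x from hwg) x
  rwa [killedOp_iterate_const_mul hg] at this

end KilledOperator

/-! ### Expectations up to the return time as series of the killed operator -/

section ReturnTime

variable {Ω : Type*} {D : ℕ → Ω → ℝ} {x : ℝ≥0}

theorem lt_returnTime_iff {k : ℕ} {ω : Ω} :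
    (k : ℕ∞) < returnTime D x ω ↔ ∀ j, 1 ≤ j → j ≤ k → walk D x j ω ≠ 0 := by
  rw [← ENat.add_one_le_iff (ENat.natCast_ne_top k), returnTime]
  simp only [le_iInf_iff]
  constructor
  · intro h j h1 hjk h0
    have := h j ⟨h1, h0⟩
    rw [← Nat.cast_one, ← Nat.cast_add, Nat.cast_le] at this
    omega
  · rintro h j ⟨h1, h0⟩
    rw [← Nat.cast_one, ← Nat.cast_add, Nat.cast_le]
    by_contra hlt
    exact h j h1 (by omega) h0

theorem succ_lt_returnTime_iff {k : ℕ} {ω : Ω} :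
    ((k + 1 : ℕ) : ℕ∞) < returnTime D x ω ↔
      (k : ℕ∞) < returnTime D x ω ∧ walk D x (k + 1) ω ≠ 0 := by
  rw [lt_returnTime_iff, lt_returnTime_iff]
  constructor
  · exact fun h => ⟨fun j h1 hj => h j h1 (by omega), h _ (by omega) le_rfl⟩
  · rintro ⟨h, h'⟩ j h1 hj
    rcases Nat.lt_or_eq_of_le hj with hj | rfl
    · exact h j h1 (by omega)
    · exact h'

theorem toENNReal_eq_tsum (n : ℕ∞) :
    (n : ℝ≥0∞) = ∑' k : ℕ, if (k : ℕ∞) < n then 1 else 0 := by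
  induction n using ENat.recTopCoe with
  | top => simp
  | coe n =>
    rw [tsum_eq_sum (s := Finset.range n)]
    · rw [Finset.sum_congr rfl (g := fun _ => 1)]
      · simp
      · intro k hk
        rw [if_pos]
        exact_mod_cast Finset.mem_range.1 hk
    · intro k hk
      rw [if_neg]
      rw [Finset.mem_range] at hk
      exact_mod_cast hk

theorem measurable_walk_pastSigma (D : ℕ → Ω → ℝ) (x : ℝ≥0) (k : ℕ) :
    Measurable[pastSigma D k] (walk D x k) := by
  induction k with
  | zero => exact measurable_const
  | succ k ih =>
    have h1 : Measurable[pastSigma D (k + 1)] (walk D x k) :=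
      ih.mono (pastSigma_mono D (Nat.le_succ k)) le_rfl
    have h2 := measurable_pastSigma_of_lt D (Nat.lt_succ_self k)
    exact (h1.coe_nnreal_real.add h2).real_toNNReal

theorem measurableSet_lt_returnTime (D : ℕ → Ω → ℝ) (x : ℝ≥0) (k : ℕ) :
    MeasurableSet[pastSigma D k] {ω | (k : ℕ∞) < returnTime D x ω} := by
  induction k with
  | zero =>
    convert MeasurableSet.univ
    ext ω
    simp only [Set.mem_ofPred_eq, Set.mem_univ, iff_true]
    exact lt_returnTime_iff.2 fun j h1 h2 => by omega
  | succ k ih =>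
    have : {ω | ((k + 1 : ℕ) : ℕ∞) < returnTime D x ω}
        = {ω | (k : ℕ∞) < returnTime D x ω} ∩ (walk D x (k + 1) ⁻¹' {0}ᶜ) := by
      ext ω; exact succ_lt_returnTime_iff
    rw [this]
    exact (pastSigma_mono D (Nat.le_succ k) _ ih).inter
      (measurable_walk_pastSigma D x (k + 1) (measurableSet_singleton 0).compl)

variable [MeasurableSpace Ω] {μ : Measure Ω} [IsProbabilityMeasure μ]

/-- The last increment is independent of the past; integrating it out replaces `f` by `killedOp f`.
Hence the induction varies `f` and fixes `x`. -/
theorem lintegral_lt_returnTime_eq (hmeas : ∀ k, Measurable (D k)) (hindep : iIndepFun D μ)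
    (hident : ∀ k, IdentDistrib (D k) (D 0) μ μ) [IsProbabilityMeasure (μ.map (D 0))] (k : ℕ)
    {f : ℝ≥0 → ℝ≥0∞} (hf : Measurable f) :
    ∫⁻ ω, (if (k : ℕ∞) < returnTime D x ω then f (walk D x k ω) else 0) ∂μ
      = (killedOp (μ.map (D 0)))^[k] f x := by
  induction k generalizing f with
  | zero =>
    have : ∀ ω, ((0 : ℕ) : ℕ∞) < returnTime D x ω := fun ω =>
      lt_returnTime_iff.2 fun j h1 h2 => by omega
    simp only [this, if_true]
    simp [walk]
  | succ k ih =>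
    rw [Function.iterate_succ_apply, ← ih (measurable_killedOp hf)]
    have hI : Measurable[pastSigma D k]
        ({ω | (k : ℕ∞) < returnTime D x ω}.indicator fun _ => (1 : ℝ≥0∞)) :=
      measurable_const.indicator (measurableSet_lt_returnTime D x k)
    have hF : Measurable fun p : (ℝ≥0 × ℝ≥0∞) × ℝ =>
        p.1.2 * ({0}ᶜ : Set ℝ≥0).indicator f ((p.1.1 : ℝ) + p.2).toNNReal :=
      measurable_fst.snd.mul ((measurable_indicator_compl_zero hf).comp (by fun_prop))
    have key := lintegral_past_eq (μ := μ) hmeas hindep hident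
      ((measurable_walk_pastSigma D x k).prodMk hI) hF
    refine Eq.trans (lintegral_congr fun ω => ?_) (key.trans (lintegral_congr fun ω => ?_))
    · by_cases h : (k : ℕ∞) < returnTime D x ω
      · by_cases h' : walk D x (k + 1) ω = 0
        · rw [if_neg (by rw [succ_lt_returnTime_iff]; tauto)]
          rw [walk] at h'
          simp [h']
        · rw [if_pos (by rw [succ_lt_returnTime_iff]; tauto)]
          rw [walk] at h' ⊢
          simp only [Set.indicator_of_mem (show ω ∈ {ω | (k : ℕ∞) < returnTime D x ω} from h), one_mul]
          exact (Set.indicator_of_mem (s := ({0}ᶜ : Set ℝ≥0)) h' f).symm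
      · rw [if_neg (by rw [succ_lt_returnTime_iff]; tauto)]
        simp [h]
    · by_cases h : (k : ℕ∞) < returnTime D x ω
      · simp only [if_pos h, killedOp_eq hf, Set.indicator_of_mem (show ω ∈ {ω | (k : ℕ∞) < returnTime D x ω} from h), one_mul]
      · simp [h]

theorem measurableSet_lt_returnTime' (hmeas : ∀ k, Measurable (D k)) (x : ℝ≥0) (k : ℕ) :
    MeasurableSet {ω | (k : ℕ∞) < returnTime D x ω} :=
  pastSigma_le hmeas k _ (measurableSet_lt_returnTime D x k)

theorem lintegral_returnTime (hmeas : ∀ k, Measurable (D k)) (hindep : iIndepFun D μ)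
    (hident : ∀ k, IdentDistrib (D k) (D 0) μ μ) [IsProbabilityMeasure (μ.map (D 0))] (x : ℝ≥0) :
    ∫⁻ ω, (returnTime D x ω : ℝ≥0∞) ∂μ = ∑' k, (killedOp (μ.map (D 0)))^[k] 1 x := by
  simp_rw [toENNReal_eq_tsum]
  rw [lintegral_tsum]
  · exact tsum_congr fun k => lintegral_lt_returnTime_eq hmeas hindep hident k measurable_one
  · exact fun k => (Measurable.ite (measurableSet_lt_returnTime' hmeas x k) measurable_const
      measurable_const).aemeasurable

theorem lintegral_pathSum (hmeas : ∀ k, Measurable (D k)) (hindep : iIndepFun D μ)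
    (hident : ∀ k, IdentDistrib (D k) (D 0) μ μ) [IsProbabilityMeasure (μ.map (D 0))] (x : ℝ≥0) :
    ∫⁻ ω, pathSum D x ω ∂μ = ∑' k, (killedOp (μ.map (D 0)))^[k] (fun y => (y : ℝ≥0∞)) x := by
  unfold pathSum
  rw [lintegral_tsum]
  · exact tsum_congr fun k =>
      lintegral_lt_returnTime_eq hmeas hindep hident k measurable_coe_nnreal_ennreal
  · intro k
    exact (Measurable.ite (measurableSet_lt_returnTime' hmeas x k)
      ((measurable_walk_pastSigma D x k).mono (pastSigma_le hmeas k) le_rfl).coe_nnreal_ennreal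
      measurable_const).aemeasurable

end ReturnTime

end RRW

namespace RRW

/-! ### Super- and subsolutions -/

section Bounds

variable {ν : Measure ℝ} [IsProbabilityMeasure ν] {δ : ℝ}

theorem killedOp_le_ofReal_integral {f : ℝ≥0 → ℝ≥0∞} (hf : Measurable f) {x : ℝ≥0} {G : ℝ → ℝ}
    (hG : Integrable G ν) (hG0 : ∀ d, 0 ≤ G d)
    (h : ∀ d, 0 < (x : ℝ) + d → f ((x : ℝ) + d).toNNReal ≤ ENNReal.ofReal (G d)) :
    killedOp ν f x ≤ ENNReal.ofReal (∫ d, G d ∂ν) := by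
  rw [killedOp_eq hf, ofReal_integral_eq_lintegral_ofReal hG (ae_of_all _ hG0)]
  refine lintegral_mono fun d => ?_
  by_cases hd : 0 < (x : ℝ) + d
  · exact (Set.indicator_le_self _ _ _).trans (h d hd)
  · rw [Real.toNNReal_of_nonpos (not_lt.1 hd)]; simp

/-- As `f` vanishes at 0, killing loses nothing. `G` may be negative, since `ENNReal.ofReal` cuts it
off at 0. -/
theorem ofReal_integral_le_killedOp {f : ℝ≥0 → ℝ≥0∞} (hf : Measurable f) (hf0 : f 0 = 0)
    {x : ℝ≥0} {G : ℝ → ℝ} (hG : Integrable G ν)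
    (h : ∀ d, ENNReal.ofReal (G d) ≤ f ((x : ℝ) + d).toNNReal) :
    ENNReal.ofReal (∫ d, G d ∂ν) ≤ killedOp ν f x := by
  rw [killedOp_eq hf]
  have hind : ({0}ᶜ : Set ℝ≥0).indicator f = f :=
    Set.indicator_eq_self.2 fun y hy hy0 => hy (by rw [Set.mem_singleton_iff.1 hy0, hf0])
  rw [hind]
  calc ENNReal.ofReal (∫ d, G d ∂ν) ≤ ENNReal.ofReal (∫ d, max (G d) 0 ∂ν) :=
        ENNReal.ofReal_le_ofReal (integral_mono hG hG.pos_part fun d => le_max_left _ _)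
    _ = ∫⁻ d, ENNReal.ofReal (max (G d) 0) ∂ν :=
        ofReal_integral_eq_lintegral_ofReal hG.pos_part (ae_of_all _ fun d => le_max_right _ _)
    _ ≤ _ := lintegral_mono fun d => by
        refine le_trans ?_ (h d)
        rw [ENNReal.ofReal_max]; simp

theorem integrable_truncated (hd : Integrable (fun d : ℝ => d) ν) (M : ℝ) :
    Integrable (fun d : ℝ => max d (-M)) ν :=
  hd.sup (integrable_const (-M))

theorem tendsto_integral_truncated (hd : Integrable (fun d : ℝ => d) ν) :
    Tendsto (fun M : ℕ => ∫ d, max d (-(M : ℝ)) ∂ν) atTop (𝓝 (∫ d, d ∂ν)) := by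
  refine tendsto_integral_of_dominated_convergence (fun d => |d|)
    (fun M => (integrable_truncated hd M).aestronglyMeasurable) hd.abs
    (fun M => ae_of_all _ fun d => ?_) (ae_of_all _ fun d => ?_)
  · have hM : (0 : ℝ) ≤ M := Nat.cast_nonneg M
    rw [Real.norm_eq_abs, abs_le]
    constructor
    · exact (neg_abs_le d).trans (le_max_left _ _)
    · exact max_le (le_abs_self d) (by linarith [abs_nonneg d])
  · obtain ⟨N, hN⟩ := exists_nat_ge (-d)
    refine tendsto_const_nhds.congr' ?_
    filter_upwards [eventually_ge_atTop N] with M hM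
    have : (N : ℝ) ≤ M := by exact_mod_cast hM
    rw [max_eq_left (by linarith)]

/-- Upper bound on the mean return time, by truncating the increments from below at `-M`. -/
theorem one_add_killedOp_le (hd : Integrable (fun d : ℝ => d) ν) {M δ' : ℝ}
    (hδ' : 0 < δ') (hmean : ∫ d, max d (-M) ∂ν = -δ') :
    1 + killedOp ν (fun x : ℝ≥0 => ENNReal.ofReal (((x : ℝ) + M) / δ'))
      ≤ fun x : ℝ≥0 => ENNReal.ofReal (((x : ℝ) + M) / δ') := by
  intro x
  have hx : (0 : ℝ) ≤ x := x.2
  have hI := integrable_truncated hd M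
  have hG : Integrable (fun d : ℝ => (x + M + max d (-M)) / δ') ν :=
    ((integrable_const _).add hI).div_const _
  -- The shift by `M` is there for this: the affine function stays nonnegative even on jumps that
  -- kill the walk.
  have hG0 : ∀ d : ℝ, 0 ≤ (x + M + max d (-M)) / δ' := fun d =>
    div_nonneg (by linarith [le_max_right d (-M)]) hδ'.le
  have h := killedOp_le_ofReal_integral
    (f := fun x : ℝ≥0 => ENNReal.ofReal (((x : ℝ) + M) / δ')) (x := x) (by fun_prop) hG hG0
    fun d hxd => by
      rw [Real.coe_toNNReal _ hxd.le]
      refine ENNReal.ofReal_le_ofReal (div_le_div_of_nonneg_right ?_ hδ'.le)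
      linarith [le_max_left d (-M)]
  have e : ∫ d, (x + M + max d (-M)) / δ' ∂ν = (x + M) / δ' - 1 := by
    rw [integral_div, integral_add (integrable_const _) hI, hmean, integral_const]
    simp only [probReal_univ, one_smul]
    field_simp
    ring
  have h0 : 0 ≤ ∫ d, (x + M + max d (-M)) / δ' ∂ν := integral_nonneg hG0
  calc (1 : ℝ≥0∞) + killedOp ν (fun x : ℝ≥0 => ENNReal.ofReal (((x : ℝ) + M) / δ')) x
      ≤ ENNReal.ofReal 1 + ENNReal.ofReal ((x + M) / δ' - 1) := by
        rw [ENNReal.ofReal_one, ← e]; exact add_le_add_right h _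
    _ = _ := by rw [← ENNReal.ofReal_add zero_le_one (e ▸ h0)]; congr 1; ring

theorem tsum_killedOp_one_le (hd : Integrable (fun d : ℝ => d) ν) {M δ' : ℝ}
    (hδ' : 0 < δ') (hmean : ∫ d, max d (-M) ∂ν = -δ') (x : ℝ≥0) :
    ∑' k, (killedOp ν)^[k] 1 x ≤ ENNReal.ofReal (((x : ℝ) + M) / δ') :=
  tsum_iterate_killedOp_le measurable_one (one_add_killedOp_le hd hδ' hmean) x

/-- One unreflected step changes x²/(2δ) by -x + c on average, with c = E d²/(2δ). The added linear
term falls by c and cancels the excess. -/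
theorem tsum_killedOp_coe_le (hδ : 0 < δ) (hd : Integrable (fun d : ℝ => d) ν)
    (hd2 : Integrable (fun d : ℝ => d ^ 2) ν) (hmeanδ : ∫ d, d ∂ν = -δ) {M δ' : ℝ}
    (hδ' : 0 < δ') (hmean : ∫ d, max d (-M) ∂ν = -δ') (x : ℝ≥0) :
    ∑' k, (killedOp ν)^[k] (fun y => (y : ℝ≥0∞)) x
      ≤ ENNReal.ofReal ((x : ℝ) ^ 2 / (2 * δ)
          + (∫ d, d ^ 2 ∂ν) / (2 * δ) * (((x : ℝ) + M) / δ')) := by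
  have hm2 : 0 ≤ ∫ d, d ^ 2 ∂ν := integral_nonneg fun d => sq_nonneg d
  set c := (∫ d, d ^ 2 ∂ν) / (2 * δ) with hc
  have hc0 : 0 ≤ c := by positivity
  refine tsum_iterate_killedOp_le (w := fun x : ℝ≥0 => ENNReal.ofReal ((x : ℝ) ^ 2 / (2 * δ)
          + c * (((x : ℝ) + M) / δ'))) measurable_coe_nnreal_ennreal (fun x => ?_) x
  have hx : (0 : ℝ) ≤ x := x.2
  have hI := integrable_truncated hd M
  have hG1 : Integrable (fun d : ℝ => (x + d) ^ 2 / (2 * δ)) ν := by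
    have : Integrable (fun d : ℝ => (x : ℝ) ^ 2 + 2 * x * d + d ^ 2) ν :=
      ((integrable_const _).add (hd.const_mul _)).add hd2
    exact (this.congr (ae_of_all _ fun d => by ring)).div_const _
  have hG2 : Integrable (fun d : ℝ => c * ((x + M + max d (-M)) / δ')) ν :=
    (((integrable_const _).add hI).div_const _).const_mul _
  have hG0 : ∀ d : ℝ, 0 ≤ (x + d) ^ 2 / (2 * δ) + c * ((x + M + max d (-M)) / δ') := fun d =>
    add_nonneg (by positivity)
      (mul_nonneg hc0 (div_nonneg (by linarith [le_max_right d (-M)]) hδ'.le))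
  have h := killedOp_le_ofReal_integral (f := fun x : ℝ≥0 => ENNReal.ofReal
      ((x : ℝ) ^ 2 / (2 * δ) + c * (((x : ℝ) + M) / δ'))) (x := x) (by fun_prop)
    (hG1.add hG2) hG0 fun d hxd => by
      rw [Real.coe_toNNReal _ hxd.le]
      refine ENNReal.ofReal_le_ofReal (add_le_add_right (mul_le_mul_of_nonneg_left
        (div_le_div_of_nonneg_right ?_ hδ'.le) hc0) _)
      linarith [le_max_left d (-M)]
  have e1 : ∫ d, (x + d) ^ 2 / (2 * δ) ∂ν = (x : ℝ) ^ 2 / (2 * δ) - x + c := by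
    have : ∀ d : ℝ, ((x : ℝ) + d) ^ 2 = (x : ℝ) ^ 2 + 2 * x * d + d ^ 2 := fun d => by ring
    simp_rw [this]
    have h3 : Integrable (fun d : ℝ => (x : ℝ) ^ 2 + 2 * x * d) ν :=
      (integrable_const _).add (hd.const_mul _)
    rw [integral_div, integral_add h3 hd2, integral_add (integrable_const _) (hd.const_mul _),
      integral_const_mul, hmeanδ, integral_const, hc]
    simp only [probReal_univ, one_smul]
    field_simp
    ring
  have e2 : ∫ d, c * ((x + M + max d (-M)) / δ') ∂ν = c * ((x + M) / δ') - c := by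
    rw [integral_const_mul, integral_div, integral_add (integrable_const _) hI, hmean,
      integral_const]
    simp only [probReal_univ, one_smul]
    field_simp
    ring
  have e : ∫ d, ((x + d) ^ 2 / (2 * δ) + c * ((x + M + max d (-M)) / δ')) ∂ν
      = (x : ℝ) ^ 2 / (2 * δ) + c * ((x + M) / δ') - x := by
    rw [integral_add hG1 hG2, e1, e2]; ring
  have h0 : 0 ≤ (x : ℝ) ^ 2 / (2 * δ) + c * ((x + M) / δ') - x := e ▸ integral_nonneg hG0
  have h' := h.trans_eq (congrArg ENNReal.ofReal e)
  calc (x : ℝ≥0∞) + killedOp ν _ x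
      ≤ ENNReal.ofReal x + ENNReal.ofReal
          ((x : ℝ) ^ 2 / (2 * δ) + c * ((x + M) / δ') - x) := by
        rw [ENNReal.ofReal_coe_nnreal]; exact add_le_add_right h' _
    _ = _ := by rw [← ENNReal.ofReal_add hx h0]; congr 1; ring

theorem ofReal_div_le_tsum_killedOp_one (hδ : 0 < δ) (hd : Integrable (fun d : ℝ => d) ν)
    (hmeanδ : ∫ d, d ∂ν = -δ) (x : ℝ≥0)
    (hfin : ∑' k, (killedOp ν)^[k] (fun y => (y : ℝ≥0∞)) x ≠ ∞) :
    ENNReal.ofReal ((x : ℝ) / δ) ≤ ∑' k, (killedOp ν)^[k] 1 x := by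
  refine le_tsum_iterate_killedOp (w := fun x : ℝ≥0 => ENNReal.ofReal ((x : ℝ) / δ))
    measurable_one measurable_coe_nnreal_ennreal (fun x => ?_)
    (c := ENNReal.ofReal δ⁻¹) ENNReal.ofReal_ne_top (fun y => ?_) x hfin
  · have h := ofReal_integral_le_killedOp (ν := ν)
      (f := fun x : ℝ≥0 => ENNReal.ofReal ((x : ℝ) / δ)) (x := x) (G := fun d => (x + d) / δ)
      (by fun_prop) (by simp) (((integrable_const _).add hd).div_const _) fun d =>
        ENNReal.ofReal_le_ofReal (div_le_div_of_nonneg_right (Real.le_coe_toNNReal _) hδ.le)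
    have e : ∫ d, ((x : ℝ) + d) / δ ∂ν = x / δ - 1 := by
      rw [integral_div, integral_add (integrable_const _) hd, hmeanδ, integral_const]
      simp only [probReal_univ, one_smul]
      field_simp
      ring
    rw [e] at h
    calc ENNReal.ofReal ((x : ℝ) / δ) = ENNReal.ofReal (1 + (x / δ - 1)) := by congr 1; ring
      _ ≤ ENNReal.ofReal 1 + ENNReal.ofReal (x / δ - 1) := ENNReal.ofReal_add_le
      _ ≤ _ := by rw [ENNReal.ofReal_one]; exact add_le_add_right h _
  · rw [← ENNReal.ofReal_coe_nnreal, ← ENNReal.ofReal_mul (by positivity), div_eq_inv_mul]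

/-- A convex minorant of `y ^ 2 / 2` with slope bounded by `K`. -/
noncomputable def cappedSquare (K y : ℝ) : ℝ := min y K * y - min y K ^ 2 / 2

theorem tangent_le_cappedSquare {K s y : ℝ} (hs : 0 ≤ s) (hsK : s ≤ K) :
    s * y - s ^ 2 / 2 ≤ cappedSquare K (max y 0) := by
  unfold cappedSquare
  rcases le_total y 0 with hy | hy
  · rw [max_eq_right hy, min_eq_left (hs.trans hsK)]
    nlinarith [mul_nonneg hs (neg_nonneg.2 hy), sq_nonneg s]
  · rw [max_eq_left hy]
    rcases le_total y K with hyK | hyK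
    · rw [min_eq_left hyK]; nlinarith [sq_nonneg (y - s)]
    · rw [min_eq_right hyK]
      nlinarith [mul_nonneg (sub_nonneg.2 hsK) (by linarith : 0 ≤ 2 * y - K - s)]

/-- The parabola is not bounded by a multiple of y, so its remainder is not controlled by the series
at hand. Capping its slope at the starting point x gives linear growth and keeps the value at x.
Along the tangent of slope s = min(y, x) the mean decrease after division by δ is s ≤ y, which makes
the capped function a subsolution. -/
theorem ofReal_sq_le_tsum_killedOp_coe (hδ : 0 < δ) (hd : Integrable (fun d : ℝ => d) ν)
    (hmeanδ : ∫ d, d ∂ν = -δ) (x : ℝ≥0)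
    (hfin : ∑' k, (killedOp ν)^[k] (fun y => (y : ℝ≥0∞)) x ≠ ∞) :
    ENNReal.ofReal ((x : ℝ) ^ 2 / (2 * δ))
      ≤ ∑' k, (killedOp ν)^[k] (fun y => (y : ℝ≥0∞)) x := by
  have hK : (0 : ℝ) ≤ x := x.2
  have hmeas : Measurable fun y : ℝ≥0 => ENNReal.ofReal (cappedSquare x y / δ) := by
    unfold cappedSquare; fun_prop
  have h := le_tsum_iterate_killedOp (ν := ν) (f := fun y => (y : ℝ≥0∞))
    (w := fun y : ℝ≥0 => ENNReal.ofReal (cappedSquare x y / δ))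
    measurable_coe_nnreal_ennreal measurable_coe_nnreal_ennreal (fun y => ?_)
    (c := ENNReal.ofReal (x / δ)) ENNReal.ofReal_ne_top (fun y => ?_) x hfin
  · refine le_trans (le_of_eq ?_) h
    congr 1
    simp only [cappedSquare, min_self]
    field_simp
    ring
  · have hy : (0 : ℝ) ≤ y := y.2
    set s := min (y : ℝ) x with hs
    have hs0 : 0 ≤ s := le_min hy hK
    have hG : Integrable (fun d : ℝ => (s * (y + d) - s ^ 2 / 2) / δ) ν :=
      ((((integrable_const _).add hd).const_mul s).sub (integrable_const _)).div_const _
    have h := ofReal_integral_le_killedOp (ν := ν) (x := y) hmeas (by simp [cappedSquare, hK])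
      hG fun d => by
        refine ENNReal.ofReal_le_ofReal (div_le_div_of_nonneg_right ?_ hδ.le)
        rw [Real.coe_toNNReal']
        exact tangent_le_cappedSquare hs0 (min_le_right _ _)
    have e : ∫ d, (s * ((y : ℝ) + d) - s ^ 2 / 2) / δ ∂ν = cappedSquare x y / δ - s := by
      have h1 : Integrable (fun d : ℝ => (y : ℝ) + d) ν := (integrable_const _).add hd
      rw [integral_div, integral_sub (h1.const_mul s) (integrable_const _), integral_const_mul,
        integral_add (integrable_const _) hd, hmeanδ, integral_const, integral_const]
      simp only [probReal_univ, one_smul, cappedSquare, ← hs]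
      field_simp
      ring
    rw [e] at h
    calc ENNReal.ofReal (cappedSquare x y / δ)
        = ENNReal.ofReal (s + (cappedSquare x y / δ - s)) := by congr 1; ring
      _ ≤ ENNReal.ofReal s + ENNReal.ofReal (cappedSquare x y / δ - s) := ENNReal.ofReal_add_le
      _ ≤ (y : ℝ≥0∞) + _ := by
        refine add_le_add ?_ h
        rw [← ENNReal.ofReal_coe_nnreal]
        exact ENNReal.ofReal_le_ofReal (min_le_left _ _)
  · have hy : (0 : ℝ) ≤ y := y.2
    rw [← ENNReal.ofReal_coe_nnreal, ← ENNReal.ofReal_mul (by positivity)]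
    refine ENNReal.ofReal_le_ofReal ?_
    rw [div_mul_eq_mul_div]
    refine div_le_div_of_nonneg_right ?_ hδ.le
    unfold cappedSquare
    nlinarith [sq_nonneg (min (y : ℝ) x), mul_le_mul_of_nonneg_right (min_le_right (y : ℝ) x) hy]

end Bounds

/-! ### Scaling limits -/

section FluidLimit

variable {ν : Measure ℝ} [IsProbabilityMeasure ν] {δ : ℝ}

theorem exists_truncation (hδ : 0 < δ) (hd : Integrable (fun d : ℝ => d) ν)
    (hmean : ∫ d, d ∂ν = -δ) {U : Set ℝ} (hU : U ∈ 𝓝 δ) :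
    ∃ M δ' : ℝ, 0 < δ' ∧ δ' ∈ U ∧ ∫ d, max d (-M) ∂ν = -δ' := by
  have h := (tendsto_integral_truncated hd).neg
  rw [hmean, neg_neg] at h
  obtain ⟨M, hM, hM'⟩ := ((h.eventually hU).and (h.eventually (lt_mem_nhds hδ))).exists
  exact ⟨M, _, hM', hM, (neg_neg _).symm⟩

theorem tsum_killedOp_coe_ne_top (hδ : 0 < δ) (hd : Integrable (fun d : ℝ => d) ν)
    (hd2 : Integrable (fun d : ℝ => d ^ 2) ν) (hmean : ∫ d, d ∂ν = -δ) (x : ℝ≥0) :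
    ∑' k, (killedOp ν)^[k] (fun y => (y : ℝ≥0∞)) x ≠ ∞ := by
  obtain ⟨M, δ', hδ', -, hm⟩ := exists_truncation hδ hd hmean univ_mem
  exact ne_top_of_le_ne_top ENNReal.ofReal_ne_top
    (tsum_killedOp_coe_le hδ hd hd2 hmean hδ' hm x)

theorem inv_pow_mul_ofReal {r : ℝ≥0} (hr : 0 < r) (n : ℕ) (t : ℝ) :
    ((r : ℝ≥0∞) ^ n)⁻¹ * ENNReal.ofReal t = ENNReal.ofReal (t / (r : ℝ) ^ n) := by
  have hr' : (0 : ℝ) < (r : ℝ) ^ n := by positivity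
  rw [ENNReal.ofReal_div_of_pos hr', ← NNReal.coe_pow, ENNReal.ofReal_coe_nnreal,
    ENNReal.coe_pow, ENNReal.div_eq_inv_mul]

theorem tendsto_const_div_coe (c : ℝ) :
    Tendsto (fun r : ℝ≥0 => c / (r : ℝ)) atTop (𝓝 0) :=
  NNReal.tendsto_coe_atTop.2 tendsto_id |>.const_div_atTop c

theorem tendsto_inv_mul_tsum_killedOp_one (hδ : 0 < δ) (hd : Integrable (fun d : ℝ => d) ν)
    (hd2 : Integrable (fun d : ℝ => d ^ 2) ν) (hmean : ∫ d, d ∂ν = -δ) (x : ℝ≥0) :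
    Tendsto (fun r : ℝ≥0 => (r : ℝ≥0∞)⁻¹ * ∑' k, (killedOp ν)^[k] 1 (r * x)) atTop
      (𝓝 (ENNReal.ofReal (δ⁻¹ * x))) := by
  refine tendsto_order.2 ⟨fun a ha => ?_, fun b hb => ?_⟩
  · filter_upwards [eventually_gt_atTop 0] with r hr
    refine ha.trans_le ?_
    have h := ofReal_div_le_tsum_killedOp_one hδ hd hmean (r * x)
      (tsum_killedOp_coe_ne_top hδ hd hd2 hmean _)
    refine le_trans (le_of_eq ?_) (mul_le_mul_right h _)
    have := inv_pow_mul_ofReal hr 1 (((r * x : ℝ≥0) : ℝ) / δ)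
    rw [pow_one, pow_one] at this
    rw [this]
    have hr' : (r : ℝ) ≠ 0 := by exact_mod_cast hr.ne'
    congr 1
    push_cast
    field_simp
  · have hcont : ContinuousAt (fun t : ℝ => ENNReal.ofReal (t⁻¹ * x)) δ :=
      ENNReal.continuous_ofReal.continuousAt.comp
        ((continuousAt_inv₀ hδ.ne').mul continuousAt_const)
    -- The truncation is chosen after `b`: the upper bound has limit x/δ', so δ' must be close to δ.
    obtain ⟨M, δ', hδ', hb', hm⟩ := exists_truncation hδ hd hmean
      (hcont.eventually (gt_mem_nhds hb))
    have hlim : Tendsto (fun r : ℝ≥0 => ENNReal.ofReal (δ'⁻¹ * x + (M / δ') / r)) atTop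
        (𝓝 (ENNReal.ofReal (δ'⁻¹ * x + 0))) :=
      (ENNReal.continuous_ofReal.tendsto _).comp
        (tendsto_const_nhds.add (tendsto_const_div_coe _))
    rw [add_zero] at hlim
    filter_upwards [hlim.eventually (gt_mem_nhds hb'), eventually_gt_atTop 0] with r hr hr0
    refine lt_of_le_of_lt ?_ hr
    refine le_trans (mul_le_mul_right (tsum_killedOp_one_le hd hδ' hm (r * x)) _)
      (le_of_eq ?_)
    have := inv_pow_mul_ofReal hr0 1 ((((r * x : ℝ≥0) : ℝ) + M) / δ')
    rw [pow_one, pow_one] at this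
    rw [this]
    have hr' : (r : ℝ) ≠ 0 := by exact_mod_cast hr0.ne'
    congr 1
    push_cast
    field_simp

theorem tendsto_inv_mul_tsum_killedOp_coe (hδ : 0 < δ) (hd : Integrable (fun d : ℝ => d) ν)
    (hd2 : Integrable (fun d : ℝ => d ^ 2) ν) (hmean : ∫ d, d ∂ν = -δ) (x : ℝ≥0) :
    Tendsto (fun r : ℝ≥0 => ((r : ℝ≥0∞) ^ 2)⁻¹ *
        ∑' k, (killedOp ν)^[k] (fun y => (y : ℝ≥0∞)) (r * x)) atTop
      (𝓝 (ENNReal.ofReal (1 / 2 * δ⁻¹ * (x : ℝ) ^ 2))) := by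
  -- Any truncation will do: it enters only the linear term, which disappears after division by r².
  obtain ⟨M, δ', hδ', -, hm⟩ := exists_truncation hδ hd hmean univ_mem
  set c := (∫ d, d ^ 2 ∂ν) / (2 * δ) with hc
  have hlim : Tendsto (fun r : ℝ≥0 => ENNReal.ofReal
      (1 / 2 * δ⁻¹ * (x : ℝ) ^ 2 + (c * x / δ' / r + c * M / δ' / r * (1 / r)))) atTop
      (𝓝 (ENNReal.ofReal (1 / 2 * δ⁻¹ * (x : ℝ) ^ 2 + (0 + 0 * 0)))) :=
    (ENNReal.continuous_ofReal.tendsto _).comp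
      (tendsto_const_nhds.add ((tendsto_const_div_coe _).add
        ((tendsto_const_div_coe _).mul (tendsto_const_div_coe _))))
  rw [mul_zero, add_zero, add_zero] at hlim
  refine tendsto_of_tendsto_of_tendsto_of_le_of_le' tendsto_const_nhds hlim ?_ ?_
  · filter_upwards [eventually_gt_atTop 0] with r hr
    have h := ofReal_sq_le_tsum_killedOp_coe hδ hd hmean (r * x)
      (tsum_killedOp_coe_ne_top hδ hd hd2 hmean _)
    refine le_trans (le_of_eq ?_) (mul_le_mul_right h _)
    rw [inv_pow_mul_ofReal hr]
    have hr' : (r : ℝ) ≠ 0 := by exact_mod_cast hr.ne'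
    congr 1
    push_cast
    field_simp
  · filter_upwards [eventually_gt_atTop 0] with r hr
    refine le_trans (mul_le_mul_right
      (tsum_killedOp_coe_le hδ hd hd2 hmean hδ' hm (r * x)) _) (le_of_eq ?_)
    rw [inv_pow_mul_ofReal hr, ← hc]
    have hr' : (r : ℝ) ≠ 0 := by exact_mod_cast hr.ne'
    congr 1
    push_cast
    field_simp

end FluidLimit

end RRW

namespace RRW

/-! ### Time reversal and convergence to equilibrium -/

section RunningMax

variable {Ω : Type*}

/-- The partial sums of the increments. -/
def increments (D : ℕ → Ω → ℝ) (n : ℕ) (ω : Ω) : ℝ := ∑ i ∈ Finset.range n, D i ω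

/-- The running maximum of the partial sums of the increments. -/
def runningMax (D : ℕ → Ω → ℝ) : ℕ → Ω → ℝ
  | 0, _ => 0
  | n + 1, ω => max (runningMax D n ω) (increments D (n + 1) ω)

/-- The state at time `n` of the walk started from `x` and driven by the first `n` increments in
reversed order. -/
def reversedWalk (D : ℕ → Ω → ℝ) (x : ℝ≥0) (n : ℕ) (ω : Ω) : ℝ≥0 :=
  (max (runningMax D n ω) (x + increments D n ω)).toNNReal

variable (D : ℕ → Ω → ℝ)

theorem increments_le_runningMax (n : ℕ) (ω : Ω) : increments D n ω ≤ runningMax D n ω := by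
  cases n with
  | zero => simp [increments, runningMax]
  | succ n => exact le_max_right _ _

theorem runningMax_nonneg (n : ℕ) (ω : Ω) : 0 ≤ runningMax D n ω := by
  induction n with
  | zero => exact le_rfl
  | succ n ih => exact ih.trans (le_max_left _ _)

theorem increments_succ (n : ℕ) (ω : Ω) : increments D (n + 1) ω = increments D n ω + D n ω :=
  Finset.sum_range_succ _ _

/-- In reversed order the newest increment acts first, so it only moves the starting point. The
maxima agree because Sₙ ≤ Mₙ and x ≥ 0. -/
theorem reversedWalk_succ (x : ℝ≥0) (n : ℕ) (ω : Ω) :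
    reversedWalk D x (n + 1) ω = reversedWalk D ((x : ℝ) + D n ω).toNNReal n ω := by
  have hx : (0 : ℝ) ≤ x := x.2
  have h1 := increments_le_runningMax D n ω
  unfold reversedWalk
  rw [runningMax, increments_succ, Real.coe_toNNReal', max_assoc,
    max_eq_right (by linarith : increments D n ω + D n ω ≤ x + (increments D n ω + D n ω))]
  congr 1
  rcases le_total ((x : ℝ) + D n ω) 0 with h | h
  · rw [max_eq_right h, zero_add, max_eq_left h1,
      max_eq_left (by linarith : x + (increments D n ω + D n ω) ≤ runningMax D n ω)]
  · rw [max_eq_left h]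
    congr 1
    ring

theorem measurable_increments_pastSigma (n : ℕ) : Measurable[pastSigma D n] (increments D n) :=
  @Finset.measurable_sum _ _ _ _ _ _ (pastSigma D n) _ (Finset.range n) fun _ hi =>
    measurable_pastSigma_of_lt D (Finset.mem_range.1 hi)

theorem measurable_runningMax_pastSigma (n : ℕ) : Measurable[pastSigma D n] (runningMax D n) := by
  induction n with
  | zero => exact measurable_const
  | succ n ih =>
    exact (ih.mono (pastSigma_mono D (Nat.le_succ n)) le_rfl).max
      (measurable_increments_pastSigma D (n + 1))

/-- The running maximum is nonnegative, so it freezes once the sums stay below 0, and x + Sₙ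
eventually drops below it. -/
theorem exists_eventually_reversedWalk_eq {D : ℕ → Ω → ℝ} {ω : Ω}
    (h : Tendsto (fun n => increments D n ω) atTop atBot) :
    ∃ z : ℝ≥0, ∀ x : ℝ≥0, ∀ᶠ n in atTop, reversedWalk D x n ω = z := by
  obtain ⟨N, hN⟩ := eventually_atTop.1 (h.eventually (eventually_le_atBot 0))
  have hconst : ∀ n, N ≤ n → runningMax D n ω = runningMax D N ω := by
    intro n hn
    induction n, hn using Nat.le_induction with
    | base => rfl
    | succ n hn ih =>
      rw [runningMax, max_eq_left, ih]
      exact (hN (n + 1) (by omega)).trans (runningMax_nonneg D n ω)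
  refine ⟨(runningMax D N ω).toNNReal, fun x => ?_⟩
  filter_upwards [h.eventually (eventually_le_atBot (-(x : ℝ))), eventually_ge_atTop N] with n hn hnN
  rw [reversedWalk, max_eq_left, hconst n hnN]
  linarith [runningMax_nonneg D n ω]

variable {D} [MeasurableSpace Ω] {μ : Measure Ω}

theorem ae_tendsto_increments_atBot (hindep : iIndepFun D μ)
    (hident : ∀ k, IdentDistrib (D k) (D 0) μ μ) (hint : Integrable (D 0) μ)
    (hneg : ∫ ω, D 0 ω ∂μ < 0) :
    ∀ᵐ ω ∂μ, Tendsto (fun n => increments D n ω) atTop atBot := by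
  filter_upwards [strong_law_ae_real D hint (fun i j hij => hindep.indepFun hij) hident] with ω hω
  refine (hω.neg_mul_atTop hneg tendsto_natCast_atTop_atTop).congr' ?_
  filter_upwards [eventually_gt_atTop 0] with n hn
  have : (n : ℝ) ≠ 0 := by exact_mod_cast hn.ne'
  rw [div_mul_cancel₀ _ this]
  rfl

theorem measurable_increments (hmeas : ∀ k, Measurable (D k)) (n : ℕ) :
    Measurable (increments D n) :=
  (measurable_increments_pastSigma D n).mono (pastSigma_le hmeas n) le_rfl

theorem measurable_runningMax (hmeas : ∀ k, Measurable (D k)) (n : ℕ) :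
    Measurable (runningMax D n) :=
  (measurable_runningMax_pastSigma D n).mono (pastSigma_le hmeas n) le_rfl

theorem measurable_reversedWalk (hmeas : ∀ k, Measurable (D k)) (x : ℝ≥0) (n : ℕ) :
    Measurable (reversedWalk D x n) :=
  ((measurable_runningMax hmeas n).max
    (measurable_const.add (measurable_increments hmeas n))).real_toNNReal

/-- The reversed walks are almost surely eventually constant, with a limit which does not depend
on the starting point. -/
theorem exists_limit_reversedWalk (hmeas : ∀ k, Measurable (D k)) (hindep : iIndepFun D μ)
    (hident : ∀ k, IdentDistrib (D k) (D 0) μ μ) (hint : Integrable (D 0) μ)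
    (hneg : ∫ ω, D 0 ω ∂μ < 0) :
    ∃ Z : Ω → ℝ≥0, Measurable Z ∧
      ∀ᵐ ω ∂μ, ∀ x : ℝ≥0, ∀ᶠ n in atTop, reversedWalk D x n ω = Z ω := by
  have hbot := ae_tendsto_increments_atBot hindep hident hint hneg
  obtain ⟨Z, hZ, hlim⟩ := measurable_limit_of_tendsto_metrizable_ae (μ := μ) (L := atTop)
    (f := fun n => reversedWalk D 0 n) (fun n => (measurable_reversedWalk hmeas 0 n).aemeasurable)
    (hbot.mono fun ω hω => by
      obtain ⟨z, hz⟩ := exists_eventually_reversedWalk_eq hω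
      exact ⟨z, tendsto_const_nhds.congr' ((hz 0).mono fun n hn => hn.symm)⟩)
  refine ⟨Z, hZ, ?_⟩
  filter_upwards [hbot, hlim] with ω hω hl x
  obtain ⟨z, hz⟩ := exists_eventually_reversedWalk_eq hω
  have : Z ω = z := tendsto_nhds_unique hl
    (tendsto_const_nhds.congr' ((hz 0).mono fun n hn => hn.symm))
  rw [this]
  exact hz x

variable [IsProbabilityMeasure μ]

/-- Reversing the increments does not change the law of the walk at a fixed time. -/
theorem lintegral_pow_rwKernel (hmeas : ∀ k, Measurable (D k)) (hindep : iIndepFun D μ)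
    (hident : ∀ k, IdentDistrib (D k) (D 0) μ μ) [IsProbabilityMeasure (μ.map (D 0))]
    {f : ℝ≥0 → ℝ≥0∞} (hf : Measurable f) (n : ℕ) (x : ℝ≥0) :
    ∫⁻ y, f y ∂((rwKernel (μ.map (D 0)) ^ n) x) = ∫⁻ ω, f (reversedWalk D x n ω) ∂μ := by
  induction n generalizing x with
  | zero =>
    rw [pow_zero_apply, lintegral_dirac' _ hf]
    simp [reversedWalk, runningMax, increments]
  | succ n ih =>
    have hF : Measurable fun p : (ℝ × ℝ) × ℝ =>
        f (max p.1.1 ((((x : ℝ) + p.2).toNNReal : ℝ) + p.1.2)).toNNReal :=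
      hf.comp (by fun_prop)
    have key := lintegral_past_eq (μ := μ) hmeas hindep hident
      ((measurable_runningMax_pastSigma D n).prodMk (measurable_increments_pastSigma D n)) hF
    have hmk : Measurable fun y => ∫⁻ z, f z ∂((rwKernel (μ.map (D 0)) ^ n) y) :=
      hf.lintegral_kernel
    rw [add_comm n 1, lintegral_pow_add _ _ _ _ hf, pow_one, lintegral_rwKernel _ _ hmk]
    simp_rw [ih, add_comm 1 n, reversedWalk_succ]
    refine Eq.trans ?_ key.symm
    refine lintegral_lintegral_swap (Measurable.aemeasurable ?_)
    have hM := measurable_runningMax hmeas n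
    have hS := measurable_increments hmeas n
    exact hF.comp (((hM.comp measurable_snd).prodMk (hS.comp measurable_snd)).prodMk measurable_fst)

/-- Since the reversed walks are eventually equal to their limit, no continuity of `f` is needed:
convergence is setwise, not merely weak. -/
theorem exists_tendsto_lintegral_pow_rwKernel (hmeas : ∀ k, Measurable (D k))
    (hindep : iIndepFun D μ) (hident : ∀ k, IdentDistrib (D k) (D 0) μ μ)
    (hint : Integrable (D 0) μ) (hneg : ∫ ω, D 0 ω ∂μ < 0)
    [IsProbabilityMeasure (μ.map (D 0))] :
    ∃ π : Measure ℝ≥0, IsProbabilityMeasure π ∧ ∀ x (f : ℝ≥0 → ℝ≥0∞), Measurable f → f ≤ 1 →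
      Tendsto (fun n => ∫⁻ y, f y ∂((rwKernel (μ.map (D 0)) ^ n) x)) atTop
        (𝓝 (∫⁻ y, f y ∂π)) := by
  obtain ⟨Z, hZ, hlim⟩ := exists_limit_reversedWalk hmeas hindep hident hint hneg
  refine ⟨μ.map Z, Measure.isProbabilityMeasure_map hZ.aemeasurable, fun x f hf hf1 => ?_⟩
  simp_rw [lintegral_pow_rwKernel hmeas hindep hident hf]
  rw [lintegral_map hf hZ]
  refine tendsto_lintegral_of_dominated_convergence 1
    (fun n => hf.comp (measurable_reversedWalk hmeas x n)) (fun n => ae_of_all _ fun ω => hf1 _)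
    (by simp) ?_
  filter_upwards [hlim] with ω hω
  exact tendsto_const_nhds.congr' ((hω x).mono fun n hn => by simp only [hn])

end RunningMax

/-! ### Invariant law: uniqueness, atom at the origin, heavy exponential tail -/

section Invariant

variable {X : Type*} [MeasurableSpace X] {P : Kernel X X} {π : Measure X}

theorem Invariant.pow (h : P.Invariant π) (n : ℕ) : (P ^ n).Invariant π := by
  induction n with
  | zero => rw [pow_zero]; exact Measure.bind_dirac
  | succ n ih => rw [pow_succ]; exact Kernel.Invariant.comp ih h

theorem Invariant.apply_eq_lintegral (h : P.Invariant π) (n : ℕ) {A : Set X}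
    (hA : MeasurableSet A) : π A = ∫⁻ x, (P ^ n) x A ∂π := by
  conv_lhs => rw [← (Invariant.pow h n).def, Measure.bind_apply hA (Kernel.aemeasurable _)]

/-- The numbers Pⁿ⁺¹(x, A) have two limits: one with test function P(·, A), one with the indicator
of A. -/
theorem invariant_of_tendsto [IsMarkovKernel P] {x : X}
    (h : ∀ f : X → ℝ≥0∞, Measurable f → f ≤ 1 →
      Tendsto (fun n => ∫⁻ y, f y ∂((P ^ n) x)) atTop (𝓝 (∫⁻ y, f y ∂π))) : P.Invariant π := by
  refine Measure.ext fun A hA => ?_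
  rw [Measure.bind_apply hA (Kernel.aemeasurable _)]
  have h1 := h (fun y => P y A) (Kernel.measurable_coe P hA) fun y => prob_le_one
  have h2 := (h (A.indicator 1) (measurable_one.indicator hA)
    (Set.indicator_le_self' fun _ _ => zero_le)).comp (tendsto_add_atTop_nat 1)
  refine tendsto_nhds_unique h1 (Tendsto.congr (fun n => ?_) (by simpa [lintegral_indicator_one hA] using h2))
  simp only [Function.comp]
  rw [Kernel.pow_add_apply_eq_lintegral _ _ _ _ hA, pow_one]

theorem eq_of_invariant_of_tendsto [IsMarkovKernel P] [IsProbabilityMeasure π]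
    (h : ∀ x A, MeasurableSet A → Tendsto (fun n => (P ^ n) x A) atTop (𝓝 (π A)))
    {π' : Measure X} [IsProbabilityMeasure π'] (hπ' : P.Invariant π') : π' = π := by
  refine Measure.ext fun A hA => ?_
  have h1 : Tendsto (fun n => ∫⁻ x, (P ^ n) x A ∂π') atTop (𝓝 (∫⁻ _, π A ∂π')) :=
    tendsto_lintegral_of_dominated_convergence 1 (fun n => Kernel.measurable_coe _ hA)
      (fun n => ae_of_all _ fun x => prob_le_one) (by simp) (ae_of_all _ fun x => h x A hA)
  rw [lintegral_const, measure_univ, mul_one] at h1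
  exact tendsto_nhds_unique
    (tendsto_const_nhds.congr fun n => Invariant.apply_eq_lintegral hπ' n hA) h1

variable {ν : Measure ℝ} [IsProbabilityMeasure ν] {ε q : ℝ} {π : Measure ℝ≥0}
  [IsProbabilityMeasure π]

theorem measure_zero_pos_of_invariant (hε : 0 < ε) (hq : 0 < q)
    (hdown : ENNReal.ofReal q ≤ ν (Set.Iic (-ε))) (hπ : (rwKernel ν).Invariant π) :
    0 < π {0} := by
  obtain ⟨n, hn⟩ := exists_measure_le_ne_zero π hε
  have hB : MeasurableSet {x : ℝ≥0 | (x : ℝ) ≤ n * ε} := by measurability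
  rw [Invariant.apply_eq_lintegral hπ n (measurableSet_singleton 0)]
  refine lt_of_lt_of_le (b := ENNReal.ofReal (q ^ n) * π {x : ℝ≥0 | (x : ℝ) ≤ n * ε})
    (ENNReal.mul_pos (by simpa using pow_pos hq n) hn) ?_
  rw [← lintegral_indicator_const hB]
  refine lintegral_mono fun x => ?_
  by_cases hx : x ∈ {x : ℝ≥0 | (x : ℝ) ≤ n * ε}
  · simpa only [Set.indicator_of_mem hx] using ofReal_pow_le_pow_apply_zero hq.le hdown n x hx
  · simp only [Set.indicator_of_notMem hx]; exact zero_le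

/-- The tail beyond nε contributes at least (e^{βε} q)ⁿ for every n; the threshold on `β` is where
this base exceeds 1. -/
theorem lintegral_exp_eq_top_of_invariant (hε : 0 < ε) (hq : 0 < q)
    (hup : ENNReal.ofReal q ≤ ν (Set.Icc ε ε⁻¹)) (hπ : (rwKernel ν).Invariant π) {β : ℝ}
    (hβ : 0 ≤ β) (hβq : -Real.log q / ε < β) :
    ∫⁻ x, ENNReal.ofReal (Real.exp (β * (x : ℝ))) ∂π = ∞ := by
  rw [div_lt_iff₀ hε] at hβq
  have h1 : 1 < Real.exp (β * ε) * q := by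
    rw [← Real.exp_log hq, ← Real.exp_add]
    exact Real.one_lt_exp_iff.2 (by linarith)
  have h2 : Tendsto (fun n : ℕ => ENNReal.ofReal ((Real.exp (β * ε) * q) ^ n)) atTop (𝓝 ∞) :=
    ENNReal.tendsto_ofReal_atTop.comp (tendsto_pow_atTop_atTop_of_one_lt h1)
  refine top_le_iff.1 (le_of_tendsto' h2 fun n => ?_)
  have hB : MeasurableSet {y : ℝ≥0 | n * ε ≤ (y : ℝ)} := by measurability
  have hπB : ENNReal.ofReal (q ^ n) ≤ π {y : ℝ≥0 | n * ε ≤ (y : ℝ)} := by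
    rw [Invariant.apply_eq_lintegral hπ n hB]
    calc ENNReal.ofReal (q ^ n) = ∫⁻ _, ENNReal.ofReal (q ^ n) ∂π := by simp
      _ ≤ _ := lintegral_mono fun x => ofReal_pow_le_pow_apply_Ici hε hq.le hup n x
  rw [mul_pow, ← Real.exp_nat_mul, ENNReal.ofReal_mul (Real.exp_pos _).le]
  refine (mul_le_mul_right hπB _).trans ?_
  rw [← lintegral_indicator_const hB]
  refine lintegral_mono fun x => ?_
  by_cases hx : x ∈ {y : ℝ≥0 | n * ε ≤ (y : ℝ)}
  · simp only [Set.indicator_of_mem hx]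
    refine ENNReal.ofReal_le_ofReal (Real.exp_le_exp.2 ?_)
    calc n * (β * ε) = β * (n * ε) := by ring
      _ ≤ β * x := mul_le_mul_of_nonneg_left hx hβ
  · simp only [Set.indicator_of_notMem hx]; exact zero_le

end Invariant

end RRW

/-! ### Assembly of the four claims -/

namespace RRW

theorem tendsto_apply_of_tendsto_lintegral {X : Type*} [MeasurableSpace X] {P : Kernel X X}
    {π : Measure X} {x : X}
    (h : ∀ f : X → ℝ≥0∞, Measurable f → f ≤ 1 →
      Tendsto (fun n => ∫⁻ y, f y ∂((P ^ n) x)) atTop (𝓝 (∫⁻ y, f y ∂π)))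
    {A : Set X} (hA : MeasurableSet A) : Tendsto (fun n => (P ^ n) x A) atTop (𝓝 (π A)) := by
  simpa only [lintegral_indicator_one hA] using h (A.indicator 1) (measurable_one.indicator hA)
    (Set.indicator_le_self' fun _ _ => zero_le)

theorem measure_Iio_zero_pos {ν : Measure ℝ} (hneg : ∫ d, d ∂ν < 0) : 0 < ν (Set.Iio 0) := by
  refine pos_iff_ne_zero.2 fun h => hneg.not_ge (integral_nonneg_of_ae ?_)
  refine measure_mono_null (fun d hd => ?_) h
  simpa using hd

end RRW

theorem proposition3p2 {Ω : Type*} [MeasurableSpace Ω] (μ : Measure Ω) [IsProbabilityMeasure μ]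
    (D : ℕ → Ω → ℝ) (hmeas : ∀ k, Measurable (D k)) (hindep : iIndepFun D μ)
    (hident : ∀ k, IdentDistrib (D k) (D 0) μ μ)
    (hvar : MemLp (D 0) 2 μ)
    (δ : ℝ) (hδ : δ = -∫ ω, D 0 ω ∂μ) (hδ_pos : 0 < δ)
    (hpos : 0 < μ {ω | 0 < D 0 ω})
    (P : Kernel ℝ≥0 ℝ≥0) (hP : P = RRW.rwKernel (μ.map (D 0))) :
    -- (i)
    ((∀ x, Integrable (RRW.lyapunov δ) (P x)) ∧
      (∃ R : ℝ≥0 → ℝ, (∃ B : ℝ, ∀ x, |R x| ≤ B) ∧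
        ∀ x, ∫ y, RRW.lyapunov δ y ∂(P x) = RRW.lyapunov δ x - (x : ℝ) + R x) ∧
      RRW.DriftV3 P (fun x => ENNReal.ofReal (RRW.lyapunov δ x)) (fun x => 1 + 1 / 2 * (x : ℝ))) ∧
    -- (ii)
    (∀ x : ℝ≥0,
      Tendsto (fun r : ℝ≥0 =>
          (r : ℝ≥0∞)⁻¹ * ∫⁻ ω, (RRW.returnTime D (r * x) ω : ℝ≥0∞) ∂μ)
        atTop (𝓝 (ENNReal.ofReal (δ⁻¹ * x))) ∧
      Tendsto (fun r : ℝ≥0 =>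
          ((r : ℝ≥0∞) ^ 2)⁻¹ * ∫⁻ ω, RRW.pathSum D (r * x) ω ∂μ)
        atTop (𝓝 (ENNReal.ofReal (1 / 2 * δ⁻¹ * (x : ℝ) ^ 2)))) ∧
    -- (iii) and (iv)
    ∃ π : Measure ℝ≥0,
      (IsProbabilityMeasure π ∧ P.Invariant π ∧
        ∀ π' : Measure ℝ≥0, IsProbabilityMeasure π' → P.Invariant π' → π' = π) ∧
      (∃ β₀ : ℝ, ∀ β : ℝ, β₀ < β →
        ∫⁻ x, ENNReal.ofReal (Real.exp (β * (x : ℝ))) ∂π = ∞) ∧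
      ∀ a : ℝ, 0 < a →
        RRW.IsGPE (RRW.scaledKernel P (RRW.expWeight a) (RRW.measurable_expWeight a)) π ∞ := by
  subst hP
  have hD0 := (hmeas 0).aemeasurable (μ := μ)
  have : IsProbabilityMeasure (μ.map (D 0)) := Measure.isProbabilityMeasure_map hD0
  have hint : Integrable (D 0) μ := hvar.integrable one_le_two
  have hd : Integrable (fun d : ℝ => d) (μ.map (D 0)) :=
    (integrable_map_measure measurable_id.aestronglyMeasurable hD0).2 hint
  have hd2 : Integrable (fun d : ℝ => d ^ 2) (μ.map (D 0)) :=
    (integrable_map_measure (by fun_prop) hD0).2 hvar.integrable_sq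
  have hmean : ∫ d, d ∂(μ.map (D 0)) = -δ := by
    rw [integral_map hD0 (by fun_prop), hδ, neg_neg]
  have hup : 0 < (μ.map (D 0)) (Set.Ioi 0) := by
    rwa [Measure.map_apply (hmeas 0) measurableSet_Ioi]
  have hdown : 0 < (μ.map (D 0)) (Set.Iio 0) := RRW.measure_Iio_zero_pos (by linarith)
  obtain ⟨ε, q, hε, hq, -, hqup, hqdown⟩ := RRW.exists_scale _ hup hdown
  refine ⟨⟨RRW.integrable_lyapunov hδ_pos hd hd2, ?_,
    RRW.driftV3_lyapunov hδ_pos hd hd2 hmean hε hq hqdown⟩, fun x => ⟨?_, ?_⟩, ?_⟩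
  · obtain ⟨B, hB⟩ := RRW.exists_bound_integral_lyapunov hδ_pos hd hd2 hmean
    exact ⟨_, ⟨B, hB⟩, fun x => by ring⟩
  · simp_rw [RRW.lintegral_returnTime hmeas hindep hident]
    exact RRW.tendsto_inv_mul_tsum_killedOp_one hδ_pos hd hd2 hmean x
  · simp_rw [RRW.lintegral_pathSum hmeas hindep hident]
    exact RRW.tendsto_inv_mul_tsum_killedOp_coe hδ_pos hd hd2 hmean x
  · obtain ⟨π, hπ, hlim⟩ := RRW.exists_tendsto_lintegral_pow_rwKernel hmeas hindep hident hint
      (by linarith)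
    have hlim' : ∀ x A, MeasurableSet A →
        Tendsto (fun n => (RRW.rwKernel (μ.map (D 0)) ^ n) x A) atTop (𝓝 (π A)) :=
      fun x A hA => RRW.tendsto_apply_of_tendsto_lintegral (hlim x) hA
    have hinv : (RRW.rwKernel (μ.map (D 0))).Invariant π := RRW.invariant_of_tendsto (hlim 0)
    refine ⟨π, ⟨hπ, hinv, fun π' _ h' => RRW.eq_of_invariant_of_tendsto hlim' h'⟩,
      ⟨max 0 (-Real.log q / ε), fun β hβ => ?_⟩, fun a ha => ?_⟩
    · exact RRW.lintegral_exp_eq_top_of_invariant hε hq hqup hinv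
        ((le_max_left _ _).trans hβ.le) ((le_max_right _ _).trans_lt hβ)
    · exact RRW.isGPE_top_of_tendsto hup hdown hlim'
        (RRW.measure_zero_pos_of_invariant hε hq hqdown hinv) ha
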